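/- Setting. Let $\alpha>1$, let $b$ be a prime, let $0\le w_1\le w_2\le\cdots$ be integers and let $\gamma_j>0$ for $j\in\mathbb N=\{1,2,\dots\}$; put $\gamma_{\mathfrak u}=\prod_{j\in\mathfrak u}\gamma_j$ for finite $\mathfrak u\subset\mathbb N$ and $[s]=\{1,\dots,s\}$. Let $H_s$ be the weighted Korobov space on $[0,1]^s$, i.e. the reproducing kernel Hilbert space of complex-valued functions with kernel $$K(x,y)=1+\sum_{\emptyset\ne\mathfrak u\subseteq[s]}\gamma_{\mathfrak u}\prod_{j\in\mathfrak u}\sum_{h\in\mathbb Z\setminus\{0\}}\frac{\exp(2\pi i h(x_j-y_j))}{|h|^\alpha}$$ and norm $\|f\|^2=\sum_{h\in\mathbb Z^s}\gamma_{\mathfrak u(h)}^{-1}\prod_{j\in\mathfrak u(h)}|h_j|^\alpha\,|\widehat f(h)|^2$, where $\mathfrak u(h)=\{j:h_j\neq0\}$. For points $x_0,\dots,x_{N-1}\in[0,1]^s$ (counted with multiplicity) the worst-case error is $\sup_{\|f\|\le1}\bigl|\int_{[0,1]^s} f-\frac1N\sum_n f(x_n)\bigr|$. Let $e(N,s)$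 be its infimum over all choices of $N$ points, let $e(0,s)=\sup_{\|f\|\le1}\bigl|\int f\bigr|$, and let $N_{\min}(\varepsilon,s)=\min\{N\ge1: e(N,s)\le\varepsilon\, e(0,s)\}$ for $s\in\mathbb N$, $\varepsilon\in(0,1]$. Integration is weakly tractable if $\log N_{\min}(\varepsilon,s)/(s+\varepsilon^{-1})\to0$ as $s+\varepsilon^{-1}\to\infty$; polynomially tractable if $N_{\min}(\varepsilon,s)\le c\,s^q\varepsilon^{-p}$ for all $s,\varepsilon$ with some $c,p,q\ge0$; strongly polynomially tractable if this holds with $q=0$. The $\varepsilon$-exponent (respectively $s$-exponent) is the infimum of all such $p$ (respectively $q$). For $N=b^m$ with $m\ge1$ and $z\in\mathbb Z^s$, let $e_{N,s}(z)$ be the worst-case error of the lattice points $\{kz/N\}$, $k=0,\dots,N-1$. Let $\mathcal Z_{N,w}=\{z\in\{1,\dots,b^{m-w}-1\}:\gcd(z,N)=1\}$ if $w<m$ and $\mathcal Z_{N,w}=\{1\}$ if $w\ge m$. A vector $z=(b^{w_1}z_1,\dots,b^{w_s}z_s)$ is said to be constructed by the reduced component-by-component algorithm if $z_1=1$ and,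 for $d=1,\dots,s-1$, $z_{d+1}\in\mathcal Z_{N,w_{d+1}}$ minimizes $e_{N,d+1}(b^{w_1}z_1,\dots,b^{w_d}z_d,b^{w_{d+1}}z_{d+1})$ over $\mathcal Z_{N,w_{d+1}}$. For $\delta\in(0,\frac{\alpha-1}2]$ write $\tau=\alpha-2\delta$ and $$c_{s,\delta}=\Bigl(2\sum_{\emptyset\ne\mathfrak u\subseteq[s]}\gamma_{\mathfrak u}^{1/\tau}\,(2\zeta(\alpha/\tau))^{|\mathfrak u|}\,b^{\max_{j\in\mathfrak u}w_j}\Bigr)^{\alpha/2-\delta}.$$ Claim. Let $z$ be any vector so constructed (for any $s,m\ge1$). 1. For all $\delta\in(0,\frac{\alpha-1}2]$: $e_{N,s}(z)\le c_{s,\delta}N^{-\alpha/2+\delta}$ and $$c_{s,\delta}\le\Bigl(2\prod_{j=1}^s\bigl(1+\gamma_j^{1/\tau}\,2\zeta(\alpha/\tau)\,b^{w_j}\bigr)\Bigr)^{\alpha/2-\delta}.$$ 2. If, for some such $\delta$, $A:=\limsup_{s\to\infty}\frac{1}{\log s}\sum_{j=1}^s\gamma_j^{1/\tau}b^{w_j}<\infty$,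 then for every $\eta>0$ there is $c_\eta>0$ such that for all $s\ge 1$: $c_{s,\delta}\le c_\eta 2^{\alpha/2-\delta}s^{\zeta(\alpha/\tau)(A+\eta)\tau}$, and hence $e_{N,s}(z)\le c_\eta 2^{\alpha/2-\delta}s^{\zeta(\alpha/\tau)(A+\eta)\tau}N^{-\alpha/2+\delta}$ for all $N=b^m$. Integration is polynomially tractable with $\varepsilon$-exponent at most $2/\tau$ and $s$-exponent at most $2\zeta(\alpha/\tau)A$; more precisely, for every $\eta>0$ there is $c>0$ with $N_{\min}(\varepsilon,s)\le c\,s^{2\zeta(\alpha/\tau)(A+\eta)}\varepsilon^{-2/\tau}$ for all $s,\varepsilon$. 3. If, for some such $\delta$, $B:=\sum_{j=1}^\infty\gamma_j^{1/\tau}b^{w_j}<\infty$, then for all $s\ge 1$: $c_{s,\delta}\le2^{\alpha/2-\delta}e^{\tau\zeta(\alpha/\tau)B}$, and hence $e_{N,s}(z)\le2^{\alpha/2-\delta}e^{\tau\zeta(\alpha/\tau)B}N^{-\alpha/2+\delta}$ for all $N=b^m$. Integration is strongly polynomially tractable with $\varepsilon$-exponent at most $2/\tau$; more precisely, there is $c>0$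 with $N_{\min}(\varepsilon,s)\le c\,\varepsilon^{-2/\tau}$ for all $s,\varepsilon$. 4. If $\lim_{s\to\infty}\frac1s\sum_{j=1}^s\gamma_jb^{w_j}=0$, then integration is weakly tractable. -/

import Mathlib

open MeasureTheory Filter Topology
open scoped ENNReal NNReal

noncomputable section

namespace Korobov

/-! Coordinates and sequences are indexed from `0`: the index `j : Fin s` (or `j : ℕ`) stands for
the `(j+1)`-st coordinate, weight, or reduction index. -/

/-- The unit cube `[0,1]^s`, with the product of the Lebesgue measures on `[0,1]`. -/
abbrev Cube (s : ℕ) : Type := Fin s → unitInterval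

/-- The trigonometric monomial `x ↦ exp (2πi h · x)`. -/
def trig {s : ℕ} (h : Fin s → ℤ) (x : Cube s) : ℂ :=
  Complex.exp (2 * Real.pi * Complex.I * ∑ j, (h j : ℂ) * ((x j : ℝ) : ℂ))

/-- The `h`-th Fourier coefficient `∫_{[0,1]^s} f(t) exp (-2πi h · t) dt`. -/
def fourierCoef {s : ℕ} (f : Cube s → ℂ) (h : Fin s → ℤ) : ℂ :=
  ∫ t, f t * trig (-h) t

/-- The set of coordinates in which `h` does not vanish. -/
def supp {s : ℕ} (h : Fin s → ℤ) : Finset (Fin s) :=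
  Finset.univ.filter fun j => h j ≠ 0

/-- The norm of the weighted Korobov space with smoothness `α` and (positive) weights
`γ_u`, `u ⊆ [s]`:
`‖f‖² = ∑_u γ_u⁻¹ ∑_{h_u ∈ (ℤ∖{0})^u} (∏_{j ∈ u} |h_j|^α) |f̂(h_u, 0)|²`. The double sum over `u` and
`h_u` is the sum over all `h ∈ ℤ^s`, with `u` the support of `h`. -/
def korobovNorm {s : ℕ} (α : ℝ) (γ : Finset (Fin s) → ℝ) (f : Cube s → ℂ) : ℝ≥0∞ :=
  (∑' h : Fin s → ℤ,
    ENNReal.ofReal ((γ (supp h))⁻¹ * (∏ j ∈ supp h, |(h j : ℝ)| ^ α) * ‖fourierCoef f h‖ ^ 2))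
    ^ (1 / 2 : ℝ)

/-- Membership in the weighted Korobov space: the functions on the cube that are the pointwise sum
of their Fourier series and have finite norm. For `α > 1` and positive weights
this is the Hilbert space with reproducing kernel
`1 + ∑_{u ≠ ∅} γ_u ∏_{j ∈ u} ∑_{h ≠ 0} exp (2πi h (x_j - y_j)) / |h|^α`. -/
def MemKorobov {s : ℕ} (α : ℝ) (γ : Finset (Fin s) → ℝ) (f : Cube s → ℂ) : Prop :=
  (∀ x, HasSum (fun h : Fin s → ℤ => fourierCoef f h * trig h x) (f x)) ∧ korobovNorm α γ f < ∞

/-- The closed unit ball of the weighted Korobov space. -/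
def unitBall {s : ℕ} (α : ℝ) (γ : Finset (Fin s) → ℝ) : Set (Cube s → ℂ) :=
  {f | MemKorobov α γ f ∧ korobovNorm α γ f ≤ 1}

/-- The worst-case error of the QMC rule `(1/N) ∑_n f(x_n)` in the weighted Korobov space. -/
def worstCaseError {s N : ℕ} (α : ℝ) (γ : Finset (Fin s) → ℝ) (P : Fin N → Cube s) : ℝ≥0∞ :=
  ⨆ f ∈ unitBall α γ, ‖(∫ t, f t) - (1 / (N : ℂ)) * ∑ n, f (P n)‖ₑ

/-- The initial error `e(0,s)`. -/
def initialError (s : ℕ) (α : ℝ) (γ : Finset (Fin s) → ℝ) : ℝ≥0∞ :=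
  ⨆ f ∈ unitBall α γ, ‖∫ t, f t‖ₑ

/-- The `N`-th minimal QMC worst-case error `e(N,s)`; points are counted with multiplicity. -/
def minimalError (N s : ℕ) (α : ℝ) (γ : Finset (Fin s) → ℝ) : ℝ≥0∞ :=
  ⨅ P : Fin N → Cube s, worstCaseError α γ P

/-- The QMC information complexity `N_min(ε,s)`: the least `N ≥ 1` with `e(N,s) ≤ ε e(0,s)`
(and `⊤` if there is none), for a family of weights `γ_{s,u}`, `u ⊆ [s]`. -/
def infoComplexity (α : ℝ) (γ : ∀ s, Finset (Fin s) → ℝ) (ε : ℝ) (s : ℕ) : ℕ∞ :=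
  ⨅ N ∈ {N : ℕ | 1 ≤ N ∧ minimalError N s α (γ s) ≤ ENNReal.ofReal ε * initialError s α (γ s)},
    (N : ℕ∞)

/-- `N_min(ε,s) ≤ c s^q ε^(-p)` for all `s ≥ 1` and `ε ∈ (0,1]`. -/
def ComplexityBound (α : ℝ) (γ : ∀ s, Finset (Fin s) → ℝ) (c p q : ℝ) : Prop :=
  ∀ s : ℕ, 1 ≤ s → ∀ ε ∈ Set.Ioc (0 : ℝ) 1,
    (infoComplexity α γ ε s : ℝ≥0∞) ≤ ENNReal.ofReal (c * (s : ℝ) ^ q * ε ^ (-p))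

/-- Polynomial QMC-tractability. -/
def PolynomiallyTractable (α : ℝ) (γ : ∀ s, Finset (Fin s) → ℝ) : Prop :=
  ∃ c p q : ℝ≥0, ComplexityBound α γ c p q

/-- Strong polynomial QMC-tractability. -/
def StronglyPolynomiallyTractable (α : ℝ) (γ : ∀ s, Finset (Fin s) → ℝ) : Prop :=
  ∃ c p : ℝ≥0, ComplexityBound α γ c p 0

/-- The `ε`-exponent of polynomial tractability. -/
def epsExponent (α : ℝ) (γ : ∀ s, Finset (Fin s) → ℝ) : ℝ≥0∞ :=
  ⨅ p ∈ {p : ℝ≥0 | ∃ c q : ℝ≥0, ComplexityBound α γ c p q}, (p : ℝ≥0∞)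

/-- The `s`-exponent of polynomial tractability. -/
def dimExponent (α : ℝ) (γ : ∀ s, Finset (Fin s) → ℝ) : ℝ≥0∞ :=
  ⨅ q ∈ {q : ℝ≥0 | ∃ c p : ℝ≥0, ComplexityBound α γ c p q}, (q : ℝ≥0∞)

/-- The `ε`-exponent of strong polynomial tractability. -/
def strongEpsExponent (α : ℝ) (γ : ∀ s, Finset (Fin s) → ℝ) : ℝ≥0∞ :=
  ⨅ p ∈ {p : ℝ≥0 | ∃ c : ℝ≥0, ComplexityBound α γ c p 0}, (p : ℝ≥0∞)

/-- Weak QMC-tractability: `N_min(ε,s)` is always finite and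
`log N_min(ε,s) / (s + ε⁻¹) → 0` as `s + ε⁻¹ → ∞`, where `s ≥ 1` and `ε ∈ (0,1]`. -/
def WeaklyTractable (α : ℝ) (γ : ∀ s, Finset (Fin s) → ℝ) : Prop :=
  (∀ s : ℕ, 1 ≤ s → ∀ ε ∈ Set.Ioc (0 : ℝ) 1, infoComplexity α γ ε s ≠ ⊤) ∧
  Tendsto
    (fun x : ℕ × ℝ => Real.log ((infoComplexity α γ x.2 x.1).toNat : ℝ) / ((x.1 : ℝ) + x.2⁻¹))
    (comap (fun x : ℕ × ℝ => (x.1 : ℝ) + x.2⁻¹) atTop ⊓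
      𝓟 {x : ℕ × ℝ | 1 ≤ x.1 ∧ x.2 ∈ Set.Ioc (0 : ℝ) 1})
    (𝓝 0)

/-- The lattice point set `{k z / N}`, `k = 0, …, N - 1`. -/
def latticePoints {s : ℕ} (N : ℕ) (z : Fin s → ℤ) : Fin N → Cube s :=
  fun k j => ⟨Int.fract (((k : ℕ) : ℝ) * (z j : ℝ) / (N : ℝ)),
    Int.fract_nonneg _, (Int.fract_lt_one _).le⟩

/-- `e_{N,s}(z)`: the worst-case error of the lattice rule with `N` points generated by `z`. -/
def latticeError {s : ℕ} (N : ℕ) (α : ℝ) (γ : Finset (Fin s) → ℝ) (z : Fin s → ℤ) : ℝ≥0∞ :=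
  worstCaseError α γ (latticePoints N z)

/-- The reduced search space `{z ∈ {1, …, b^(m-w) - 1} : gcd(z, b^m) = 1}` for `w < m`, and `{1}`
for `w ≥ m`. -/
def searchSpace (b m w : ℕ) : Set ℕ :=
  if w < m then {z | 1 ≤ z ∧ z ≤ b ^ (m - w) - 1 ∧ Nat.gcd z (b ^ m) = 1} else {1}

/-- The generating vector `(b^(w_1) z_1, …, b^(w_s) z_s)`. -/
def genVector (b : ℕ) (w z : ℕ → ℕ) (s : ℕ) : Fin s → ℤ :=
  fun j => (b : ℤ) ^ w j * (z j : ℤ)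

/-- `z_1, …, z_s` is a possible output of the reduced component-by-component construction with
`N = b^m`: `z_1 = 1`, and each later `z_d` minimizes, over its search space, the `d`-dimensional
worst-case error with the earlier components kept fixed. Only the first `s` entries of `z`
matter. -/
def IsReducedCBC (b m : ℕ) (α : ℝ) (γ : ∀ s, Finset (Fin s) → ℝ) (w : ℕ → ℕ) (s : ℕ)
    (z : ℕ → ℕ) : Prop :=
  z 0 = 1 ∧ ∀ d : ℕ, 1 ≤ d → d < s →
    z d ∈ searchSpace b m (w d) ∧
    ∀ y ∈ searchSpace b m (w d),
      latticeError (b ^ m) α (γ (d + 1)) (genVector b w z (d + 1)) ≤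
        latticeError (b ^ m) α (γ (d + 1)) (genVector b w (Function.update z d y) (d + 1))

/-- Product weights `γ_u = ∏_{j ∈ u} γ_j`. -/
def prodWeights (γ : ℕ → ℝ) (s : ℕ) (u : Finset (Fin s)) : ℝ :=
  ∏ j ∈ u, γ j

/-- The Riemann zeta function at a real argument `x > 1`. -/
def zeta (x : ℝ) : ℝ := (riemannZeta (x : ℂ)).re

/-- The factor `(2 ∑_{∅ ≠ u ⊆ [s]} γ_u^(1/(α-2δ)) (2ζ(α/(α-2δ)))^|u| b^(max_{j∈u} w_j))^(α/2-δ)`. -/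
def errorFactor (b s : ℕ) (α : ℝ) (γ : Finset (Fin s) → ℝ) (δ : ℝ) (w : ℕ → ℕ) : ℝ :=
  (2 * ∑ u ∈ (Finset.univ : Finset (Finset (Fin s))).filter (fun u => u.Nonempty),
    γ u ^ (1 / (α - 2 * δ)) * (2 * zeta (α / (α - 2 * δ))) ^ u.card *
      (b : ℝ) ^ (u.sup fun j => w j)) ^ (α / 2 - δ)

/-- The partial sum `∑_{j=1}^s γ_j^(1/(α-2δ)) b^(w_j)`. -/
def weightSum (b : ℕ) (α : ℝ) (γ : ℕ → ℝ) (δ : ℝ) (w : ℕ → ℕ) (s : ℕ) : ℝ :=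
  ∑ j ∈ Finset.range s, γ j ^ (1 / (α - 2 * δ)) * (b : ℝ) ^ w j

end Korobov

end

open Korobov

/-! The squared worst-case error of a lattice rule is the sum, over the nonzero `h` with `N ∣ h ·
z`, of the weight `vecWeight` that is reciprocal to the one in the Korobov norm (`latticeError_eq`).
Averaging a character over the lattice points gives 1 or 0, so the quadrature error is a sum of
Fourier coefficients over the dual lattice. Cauchy–Schwarz bounds it from above, and trigonometric
polynomials attain the bound in the limit.

Appending a component adds to this sum an increment `dualIncr`. The old sum is finite and common to
all candidates, so a greedy step minimizes the increment. With `l = 1/τ`, subadditivity of `x ↦ x ^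
l` replaces `(α, γ_j)` by `(α/τ, γ_j^l)`, where `α/τ > 1` keeps the sums finite. The minimizer is at
most the mean over the search space. Counting solutions of a linear congruence bounds the sum over
candidates independently of the size of the space (`sum_dualIncr_le`), and that size is at least `N
/ (2 b^w)`, so each increment satisfies a bound of order `b^w / N`
(`dualIncr_rpow_le_of_forall_le`).

Summing the increments gives `factorSum`. As `w` is monotone, the maximum of `w` over `u` is
attained at the largest element of `u`, so grouping subsets by largest element identifies this sum
with the one in `errorFactor`. The remaining bounds use `1 + x ≤ exp x`. For tractability, `N` is a
power of `b` just above the real number that the error bound requires (`infoComplexity_le`), and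
growth of the weight sums controls the dependence on `s`. -/

noncomputable section

namespace Korobov

/-! ### Trigonometric monomials -/

lemma trig_eq_prod {s : ℕ} (h : Fin s → ℤ) (x : Cube s) :
    trig h x = ∏ j, Complex.exp (2 * Real.pi * Complex.I * (h j) * ((x j : ℝ) : ℂ)) := by
  rw [trig, ← Complex.exp_sum, Finset.mul_sum]
  simp only [mul_assoc]

@[simp] lemma trig_zero {s : ℕ} (x : Cube s) : trig 0 x = 1 := by simp [trig]

lemma trig_add {s : ℕ} (h k : Fin s → ℤ) (x : Cube s) :
    trig (h + k) x = trig h x * trig k x := by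
  rw [trig, trig, trig, ← Complex.exp_add, ← mul_add, ← Finset.sum_add_distrib]
  congr 2
  refine Finset.sum_congr rfl fun j _ => ?_
  simp [add_mul]

lemma continuous_trig {s : ℕ} (h : Fin s → ℤ) : Continuous (trig h) := by
  unfold trig
  fun_prop

lemma integral_exp_unitInterval (n : ℤ) :
    ∫ x : unitInterval, Complex.exp (2 * Real.pi * Complex.I * n * ((x : ℝ) : ℂ)) =
      if n = 0 then 1 else 0 := by
  split_ifs with hn
  · simp [hn]
  have hc : (2 * Real.pi * Complex.I * n : ℂ) ≠ 0 := by
    simp [Real.pi_ne_zero, hn]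
  have h1 := unitInterval.measurePreserving_coe.integral_comp
    unitInterval.measurableEmbedding_coe
    (fun x : ℝ => Complex.exp (2 * Real.pi * Complex.I * n * (x : ℂ)))
  rw [h1, unitInterval, integral_Icc_eq_integral_Ioc,
    ← intervalIntegral.integral_of_le zero_le_one, integral_exp_mul_complex hc]
  have : Complex.exp (2 * Real.pi * Complex.I * n * (1 : ℝ)) = 1 := by
    rw [Complex.exp_eq_one_iff]
    exact ⟨n, by push_cast; ring⟩
  rw [this]
  simp

lemma integral_trig {s : ℕ} (h : Fin s → ℤ) :
    ∫ x, trig h x = if h = 0 then 1 else 0 := by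
  simp_rw [trig_eq_prod]
  rw [integral_fintype_prod_volume_eq_prod (fun j (x : unitInterval) =>
    Complex.exp (2 * Real.pi * Complex.I * (h j) * ((x : ℝ) : ℂ)))]
  simp_rw [integral_exp_unitInterval]
  split_ifs with h0
  · simp [h0]
  · obtain ⟨j, hj⟩ := Function.ne_iff.1 h0
    exact Finset.prod_eq_zero (Finset.mem_univ j) (by simpa using hj)

lemma fourierCoef_zero {s : ℕ} (f : Cube s → ℂ) : fourierCoef f 0 = ∫ t, f t := by
  simp [fourierCoef]

lemma fourierCoef_sum_trig {s : ℕ} (F : Finset (Fin s → ℤ)) (c : (Fin s → ℤ) → ℂ)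
    (h : Fin s → ℤ) :
    fourierCoef (fun x => ∑ k ∈ F, c k * trig k x) h = if h ∈ F then c h else 0 := by
  have h1 : ∀ t : Cube s, (∑ k ∈ F, c k * trig k t) * trig (-h) t =
      ∑ k ∈ F, c k * trig (k - h) t := fun t => by
    rw [Finset.sum_mul]
    exact Finset.sum_congr rfl fun k _ => by rw [mul_assoc, ← trig_add, sub_eq_add_neg]
  simp_rw [fourierCoef, h1]
  rw [integral_finsetSum]
  · simp_rw [integral_const_mul, integral_trig, sub_eq_zero]
    simp
  · intro k _
    have : Continuous fun t : Cube s => c k * trig (k - h) t :=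
      continuous_const.mul (continuous_trig _)
    exact this.integrable_of_hasCompactSupport (HasCompactSupport.of_compactSpace _)

/-! ### Exponential sums over lattice points -/

lemma trig_latticePoints {s N : ℕ} (z h : Fin s → ℤ) (k : Fin N) :
    trig h (latticePoints N z k) =
      Complex.exp (2 * Real.pi * Complex.I * ((∑ j, h j * z j : ℤ) : ℂ) / N) ^ (k : ℕ) := by
  rw [← Complex.exp_nat_mul, trig, Complex.exp_eq_exp_iff_exists_int]
  -- Reduction mod 1 shifts `h · x` by an integer built from the floors; the exponential does not
  -- see it.
  refine ⟨-∑ j, h j * ⌊((k : ℕ) : ℝ) * (z j : ℝ) / (N : ℝ)⌋, ?_⟩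
  simp only [latticePoints, Int.fract]
  push_cast
  rw [neg_mul, Finset.sum_mul, ← sub_eq_add_neg, Finset.mul_sum, Finset.mul_sum, Finset.sum_div,
    Finset.mul_sum, ← Finset.sum_sub_distrib]
  refine Finset.sum_congr rfl fun j _ => ?_
  ring

/-- Orthogonality of characters: the values form a geometric progression whose ratio is an `N`-th
root of unity, equal to 1 exactly under the divisibility. -/
lemma mean_trig_latticePoints {s N : ℕ} (hN : 0 < N) (z h : Fin s → ℤ) :
    (1 / (N : ℂ)) * ∑ n, trig h (latticePoints N z n) =
      if (N : ℤ) ∣ ∑ j, h j * z j then 1 else 0 := by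
  have hN' : (N : ℂ) ≠ 0 := by exact_mod_cast hN.ne'
  simp_rw [trig_latticePoints]
  rw [Fin.sum_univ_eq_sum_range (fun k => Complex.exp (2 * Real.pi * Complex.I *
    ((∑ j, h j * z j : ℤ) : ℂ) / N) ^ k) N]
  generalize (∑ j, h j * z j : ℤ) = a
  split_ifs with hd
  · obtain ⟨c, rfl⟩ := hd
    have : Complex.exp (2 * Real.pi * Complex.I * (((N : ℤ) * c : ℤ) : ℂ) / N) = 1 := by
      rw [Complex.exp_eq_one_iff]
      exact ⟨c, by push_cast; field_simp⟩
    simp only [this, one_pow]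
    simp [hN']
  · have h1 : Complex.exp (2 * Real.pi * Complex.I * (a : ℂ) / N) ≠ 1 := by
      rw [Ne, Complex.exp_eq_one_iff]
      rintro ⟨c, hc⟩
      have hp : (2 * Real.pi * Complex.I : ℂ) ≠ 0 := by simp [Real.pi_ne_zero]
      apply hd
      refine ⟨c, ?_⟩
      have : (2 * Real.pi * Complex.I : ℂ) * a = (2 * Real.pi * Complex.I) * (N * c) := by
        rw [div_eq_iff hN'] at hc
        rw [hc]; ring
      exact_mod_cast mul_left_cancel₀ hp this
    have h2 := mul_geom_sum (Complex.exp (2 * Real.pi * Complex.I * (a : ℂ) / N)) N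
    have h3 : Complex.exp (2 * Real.pi * Complex.I * (a : ℂ) / N) ^ N = 1 := by
      rw [← Complex.exp_nat_mul, Complex.exp_eq_one_iff]
      exact ⟨a, by field_simp⟩
    rw [h3, sub_self, mul_eq_zero, sub_eq_zero] at h2
    rw [h2.resolve_left h1, mul_zero]

/-! ### The worst-case error as a sum over the dual lattice -/

/-- The weight of the frequency `k` in one coordinate: `1` if `k = 0`, and `g |k|^(-a)` otherwise. -/
def freqWeight (a g : ℝ) (k : ℤ) : ℝ := if k = 0 then 1 else g * |(k : ℝ)| ^ (-a)

/-- The weight of a frequency vector, the product of the weights of its coordinates. -/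
def vecWeight (a : ℝ) (g : ℕ → ℝ) {s : ℕ} (h : Fin s → ℤ) : ℝ := ∏ j : Fin s, freqWeight a (g j) (h j)

/-- The sum of the weights over the nonzero `h` with `h · z` divisible by `N`. -/
def dualSum (N : ℕ) (a : ℝ) (g : ℕ → ℝ) {s : ℕ} (z : Fin s → ℤ) : ℝ≥0∞ :=
  ∑' h : Fin s → ℤ, if h ≠ 0 ∧ (N : ℤ) ∣ ∑ j, h j * z j then
    ENNReal.ofReal (vecWeight a g h) else 0

lemma freqWeight_pos {a g : ℝ} (hg : 0 < g) (k : ℤ) : 0 < freqWeight a g k := by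
  unfold freqWeight
  split_ifs with hk
  · exact one_pos
  · have : 0 < |(k : ℝ)| := by positivity
    positivity

lemma vecWeight_pos {a : ℝ} {g : ℕ → ℝ} (hg : ∀ j, 0 < g j) {s : ℕ} (h : Fin s → ℤ) :
    0 < vecWeight a g h :=
  Finset.prod_pos fun j _ => freqWeight_pos (hg j) _

lemma vecWeight_zero {a : ℝ} {g : ℕ → ℝ} {s : ℕ} : vecWeight a g (0 : Fin s → ℤ) = 1 := by
  simp [vecWeight, freqWeight]

lemma korobov_weight_eq {a : ℝ} {g : ℕ → ℝ} {s : ℕ} (h : Fin s → ℤ) :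
    (prodWeights g s (supp h))⁻¹ * (∏ j ∈ supp h, |(h j : ℝ)| ^ a) = (vecWeight a g h)⁻¹ := by
  rw [prodWeights, vecWeight, ← Finset.prod_inv_distrib, ← Finset.prod_inv_distrib,
    ← Finset.prod_mul_distrib, supp, Finset.prod_filter]
  refine Finset.prod_congr rfl fun j _ => ?_
  rw [freqWeight]
  by_cases hj : h j = 0
  · simp [hj]
  · simp [hj, Real.rpow_neg, mul_comm]

lemma korobovNorm_le_one_iff {s : ℕ} {a : ℝ} {g : ℕ → ℝ} {f : Cube s → ℂ} :
    korobovNorm a (prodWeights g s) f ≤ 1 ↔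
      ∑' h, ENNReal.ofReal ((vecWeight a g h)⁻¹ * ‖fourierCoef f h‖ ^ 2) ≤ 1 := by
  simp_rw [korobovNorm, korobov_weight_eq]
  rw [one_div, ENNReal.rpow_inv_le_iff (by norm_num), ENNReal.one_rpow]

lemma tsum_mul_le_sqrt_mul_sqrt {ι : Type*} (f g : ι → ℝ≥0∞) :
    ∑' i, f i * g i ≤ (∑' i, f i ^ 2) ^ (1 / 2 : ℝ) * (∑' i, g i ^ 2) ^ (1 / 2 : ℝ) := by
  rw [ENNReal.tsum_eq_iSup_sum]
  refine iSup_le fun F => (ENNReal.inner_le_Lp_mul_Lq F f g Real.HolderConjugate.two_two).trans ?_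
  simp only [ENNReal.rpow_two]
  gcongr <;> exact ENNReal.sum_le_tsum F

/-- Pointwise convergence of the Fourier series at the finitely many nodes allows averaging term by
term. Frequencies off the dual lattice cancel, and `h = 0` contributes the integral. -/
lemma qmc_error_hasSum {s N : ℕ} (hN : 0 < N) {f : Cube s → ℂ}
    (hf : ∀ x, HasSum (fun h : Fin s → ℤ => fourierCoef f h * trig h x) (f x)) (z : Fin s → ℤ) :
    HasSum (fun h : Fin s → ℤ => if h ≠ 0 ∧ (N : ℤ) ∣ ∑ j, h j * z j then fourierCoef f h else 0)
      ((1 / (N : ℂ)) * ∑ n, f (latticePoints N z n) - ∫ t, f t) := by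
  have h1 : HasSum (fun h : Fin s → ℤ => (1 / (N : ℂ)) *
      ∑ n, fourierCoef f h * trig h (latticePoints N z n))
      ((1 / (N : ℂ)) * ∑ n, f (latticePoints N z n)) :=
    (hasSum_sum fun n _ => hf (latticePoints N z n)).mul_left _
  have h2 : HasSum (fun h : Fin s → ℤ => if h = 0 then ∫ t, f t else 0) (∫ t, f t) :=
    hasSum_ite_eq 0 _
  have h3 : (fun h : Fin s → ℤ => if h ≠ 0 ∧ (N : ℤ) ∣ ∑ j, h j * z j then fourierCoef f h else 0) =
      fun h => (1 / (N : ℂ)) * ∑ n, fourierCoef f h * trig h (latticePoints N z n) -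
        if h = 0 then ∫ t, f t else 0 := by
    funext h
    rw [← Finset.mul_sum, mul_left_comm, mean_trig_latticePoints hN]
    by_cases h0 : h = 0
    · simp [h0, fourierCoef_zero]
    · simp [h0]
  rw [h3]
  exact h1.sub h2

lemma sum_trig_mem_unitBall {s : ℕ} {a : ℝ} {g : ℕ → ℝ} (F : Finset (Fin s → ℤ))
    (c : (Fin s → ℤ) → ℂ)
    (hc : ∑ h ∈ F, ENNReal.ofReal ((vecWeight a g h)⁻¹ * ‖c h‖ ^ 2) ≤ 1) :
    (fun x => ∑ k ∈ F, c k * trig k x) ∈ unitBall a (prodWeights g s) := by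
  have h1 : korobovNorm a (prodWeights g s) (fun x => ∑ k ∈ F, c k * trig k x) ≤ 1 := by
    rw [korobovNorm_le_one_iff]
    refine le_of_eq_of_le ?_ hc
    rw [tsum_eq_sum (s := F)]
    · exact Finset.sum_congr rfl fun h hh => by rw [fourierCoef_sum_trig, if_pos hh]
    · intro h hh
      rw [fourierCoef_sum_trig, if_neg hh]
      simp
  refine ⟨⟨fun x => ?_, h1.trans_lt ENNReal.one_lt_top⟩, h1⟩
  have : ∑ k ∈ F, c k * trig k x = ∑ k ∈ F, (if k ∈ F then c k else 0) * trig k x :=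
    Finset.sum_congr rfl fun h hh => by rw [if_pos hh]
  simp only [fourierCoef_sum_trig]
  rw [this]
  exact hasSum_sum_of_ne_finset_zero fun h hh => by simp [hh]

/-- The constant function 1 has norm 1. Only this lower bound is needed: it turns an absolute error
of at most `ε` into a normalized one. -/
lemma one_le_initialError {s : ℕ} {a : ℝ} {g : ℕ → ℝ} :
    1 ≤ initialError s a (prodWeights g s) := by
  have h1 : (fun x => ∑ k ∈ ({0} : Finset (Fin s → ℤ)), (1 : ℂ) * trig k x) ∈
      unitBall a (prodWeights g s) :=
    sum_trig_mem_unitBall {0} (fun _ => 1) (by simp [vecWeight_zero])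
  refine le_trans ?_ (le_iSup₂ (f := fun f (_ : f ∈ unitBall a (prodWeights g s)) =>
    ‖∫ t, f t‖ₑ) _ h1)
  simp

lemma latticeError_le {s N : ℕ} (hN : 0 < N) {a : ℝ} {g : ℕ → ℝ} (hg : ∀ j, 0 < g j)
    (z : Fin s → ℤ) :
    latticeError N a (prodWeights g s) z ≤ dualSum N a g z ^ (1 / 2 : ℝ) := by
  refine iSup₂_le fun f hf => ?_
  have hnorm := korobovNorm_le_one_iff.1 hf.2
  have hs := qmc_error_hasSum hN hf.1.1 z
  rw [← enorm_neg, neg_sub, ← hs.tsum_eq]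
  refine enorm_tsum_le_tsum_enorm.trans ?_
  set D : (Fin s → ℤ) → Prop := fun h => h ≠ 0 ∧ (N : ℤ) ∣ ∑ j, h j * z j
  classical
  -- Each coefficient is split as `√v · (√v⁻¹ |f̂(h)|)`; after Cauchy–Schwarz the second factor is
  -- the norm, which is at most 1.
  have h1 : ∀ h : Fin s → ℤ, ‖if D h then fourierCoef f h else 0‖ₑ =
      (if D h then ENNReal.ofReal (√(vecWeight a g h)) else 0) *
        ENNReal.ofReal (√((vecWeight a g h)⁻¹) * ‖fourierCoef f h‖) := fun h => by
    have := Real.sqrt_pos.2 (vecWeight_pos (a := a) hg h)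
    split_ifs
    · rw [← ENNReal.ofReal_mul (Real.sqrt_nonneg _), ← mul_assoc, Real.sqrt_inv,
        mul_inv_cancel₀ this.ne', one_mul, ofReal_norm]
    · simp
  have h2 : ∀ h : Fin s → ℤ,
      (if D h then ENNReal.ofReal (√(vecWeight a g h)) else 0) ^ 2 =
      if D h then ENNReal.ofReal (vecWeight a g h) else 0 := fun h => by
    split_ifs
    · rw [← ENNReal.ofReal_pow (Real.sqrt_nonneg _), Real.sq_sqrt (vecWeight_pos hg h).le]
    · simp
  have h3 : ∀ h : Fin s → ℤ, ENNReal.ofReal (√((vecWeight a g h)⁻¹) * ‖fourierCoef f h‖) ^ 2 =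
      ENNReal.ofReal ((vecWeight a g h)⁻¹ * ‖fourierCoef f h‖ ^ 2) := fun h => by
    rw [← ENNReal.ofReal_pow (by positivity), mul_pow,
      Real.sq_sqrt (inv_nonneg.2 (vecWeight_pos hg h).le)]
  calc ∑' h, ‖if D h then fourierCoef f h else 0‖ₑ
      = ∑' h, (if D h then ENNReal.ofReal (√(vecWeight a g h)) else 0) *
        ENNReal.ofReal (√((vecWeight a g h)⁻¹) * ‖fourierCoef f h‖) := tsum_congr h1
    _ ≤ _ := tsum_mul_le_sqrt_mul_sqrt _ _
    _ ≤ (∑' h, if D h then ENNReal.ofReal (vecWeight a g h) else 0) ^ (1 / 2 : ℝ) *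
        1 ^ (1 / 2 : ℝ) := by
      simp_rw [h2, h3]
      gcongr
    _ = _ := by
      rw [ENNReal.one_rpow, mul_one, dualSum]

/-- Testing on trigonometric polynomials supported on finite parts of the dual lattice and taking
the supremum avoids constructing an infinite extremal function. -/
lemma le_latticeError {s N : ℕ} (hN : 0 < N) {a : ℝ} {g : ℕ → ℝ} (hg : ∀ j, 0 < g j)
    (z : Fin s → ℤ) :
    dualSum N a g z ^ (1 / 2 : ℝ) ≤ latticeError N a (prodWeights g s) z := by
  rw [one_div, ENNReal.rpow_inv_le_iff (by norm_num), dualSum, ENNReal.tsum_eq_iSup_sum]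
  refine iSup_le fun F => ?_
  rw [← Finset.sum_filter]
  set F' := F.filter fun h => h ≠ 0 ∧ (N : ℤ) ∣ ∑ j, h j * z j with hF'
  rw [← ENNReal.ofReal_sum_of_nonneg fun h _ => (vecWeight_pos hg h).le]
  set S := ∑ h ∈ F', vecWeight a g h with hS
  have hS0 : 0 ≤ S := Finset.sum_nonneg fun h _ => (vecWeight_pos hg h).le
  rcases hS0.eq_or_lt with h0 | hSpos
  · simp [← h0]
  have hsq : 0 < √S := Real.sqrt_pos.2 hSpos
  -- Equality case of Cauchy–Schwarz: with these coefficients the squared norm is `∑ v / S = 1` and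
  -- the error is `∑ v / √S = √S`.
  set c : (Fin s → ℤ) → ℂ := fun h => ((vecWeight a g h / √S : ℝ) : ℂ) with hc
  have hmem : (fun x => ∑ k ∈ F', c k * trig k x) ∈ unitBall a (prodWeights g s) := by
    refine sum_trig_mem_unitBall F' c ?_
    rw [← ENNReal.ofReal_sum_of_nonneg fun h _ => by
      have := vecWeight_pos (a := a) hg h
      positivity]
    rw [← ENNReal.ofReal_one]
    refine ENNReal.ofReal_le_ofReal (le_of_eq ?_)
    have : ∀ h ∈ F', (vecWeight a g h)⁻¹ * ‖c h‖ ^ 2 = vecWeight a g h / S := fun h _ => by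
      have hv := vecWeight_pos (a := a) hg h
      rw [hc, Complex.norm_real, Real.norm_of_nonneg (by positivity), div_pow, Real.sq_sqrt hS0]
      field_simp
    rw [Finset.sum_congr rfl this, ← Finset.sum_div, div_self hSpos.ne']
  have herr := qmc_error_hasSum hN hmem.1.1 z
  have hval : (1 / (N : ℂ)) * ∑ n, (∑ k ∈ F', c k * trig k (latticePoints N z n)) -
      ∫ t, (∑ k ∈ F', c k * trig k t) = ((√S : ℝ) : ℂ) := by
    refine herr.unique ?_
    have hs : ((√S : ℝ) : ℂ) = ∑ h ∈ F', if h ≠ 0 ∧ (N : ℤ) ∣ ∑ j, h j * z j then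
        fourierCoef (fun x => ∑ k ∈ F', c k * trig k x) h else 0 := by
      have : ∀ h ∈ F', (if h ≠ 0 ∧ (N : ℤ) ∣ ∑ j, h j * z j then
        fourierCoef (fun x => ∑ k ∈ F', c k * trig k x) h else 0) = c h := fun h hh => by
        rw [if_pos (Finset.mem_filter.1 hh).2, fourierCoef_sum_trig, if_pos hh]
      rw [Finset.sum_congr rfl this, hc, ← Complex.ofReal_sum, ← Finset.sum_div, ← hS,
        Real.div_sqrt]
    rw [hs]
    refine hasSum_sum_of_ne_finset_zero fun h hh => ?_
    rw [fourierCoef_sum_trig, if_neg hh, ite_self]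
  have h2 : ENNReal.ofReal (√S) ≤ latticeError N a (prodWeights g s) z := by
    refine le_trans (le_of_eq ?_) (le_iSup₂ (f := fun f (_ : f ∈ unitBall a (prodWeights g s)) =>
      ‖(∫ t, f t) - (1 / (N : ℂ)) * ∑ n, f (latticePoints N z n)‖ₑ) _ hmem)
    rw [← enorm_neg, neg_sub, hval, ← ofReal_norm, Complex.norm_real,
      Real.norm_of_nonneg hsq.le]
  calc ENNReal.ofReal S = ENNReal.ofReal (√S) ^ (2 : ℝ) := by
        rw [ENNReal.rpow_two, ← ENNReal.ofReal_pow hsq.le, Real.sq_sqrt hS0]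
    _ ≤ _ := by gcongr

lemma latticeError_eq {s N : ℕ} (hN : 0 < N) {a : ℝ} {g : ℕ → ℝ} (hg : ∀ j, 0 < g j)
    (z : Fin s → ℤ) :
    latticeError N a (prodWeights g s) z = dualSum N a g z ^ (1 / 2 : ℝ) :=
  (latticeError_le hN hg z).antisymm (le_latticeError hN hg z)

/-! ### Sums of weights -/

/-- The sum `∑_{k ≠ 0} |k|^(-β)`. -/
def powSum (β : ℝ) : ℝ≥0∞ := ∑' k : ℤ, if k = 0 then 0 else ENNReal.ofReal (|(k : ℝ)| ^ (-β))

lemma zeta_eq_tsum {β : ℝ} (hβ : 1 < β) : zeta β = ∑' n : ℕ, 1 / ((n : ℝ) + 1) ^ β := by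
  have h1 := zeta_eq_tsum_one_div_nat_add_one_cpow (s := (β : ℂ)) (by simpa using hβ)
  have h2 : ∀ n : ℕ, (1 : ℂ) / ((n : ℂ) + 1) ^ (β : ℂ) = ((1 / ((n : ℝ) + 1) ^ β : ℝ) : ℂ) := by
    intro n
    have : (0 : ℝ) ≤ (n : ℝ) + 1 := by positivity
    rw [Complex.ofReal_div, Complex.ofReal_cpow this]
    simp
  rw [zeta, h1]
  simp_rw [h2]
  rw [← Complex.ofReal_tsum, Complex.ofReal_re]

lemma summable_zeta {β : ℝ} (hβ : 1 < β) : Summable fun n : ℕ => 1 / ((n : ℝ) + 1) ^ β := by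
  have := (summable_nat_add_iff 1).2 (Real.summable_one_div_nat_rpow.2 hβ)
  simpa using this

lemma zeta_pos {β : ℝ} (hβ : 1 < β) : 0 < zeta β := by
  rw [zeta_eq_tsum hβ]
  exact (summable_zeta hβ).tsum_pos (fun n => by positivity) 0 (by norm_num)

lemma powSum_eq {β : ℝ} (hβ : 1 < β) : powSum β = ENNReal.ofReal (2 * zeta β) := by
  have h0 : ∑' n : ℕ, ENNReal.ofReal (1 / ((n : ℝ) + 1) ^ β) = ENNReal.ofReal (zeta β) := by
    rw [zeta_eq_tsum hβ, ENNReal.ofReal_tsum_of_nonneg (fun n => by positivity) (summable_zeta hβ)]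
  have h1 : HasSum (fun n : ℕ => ENNReal.ofReal (1 / ((n : ℝ) + 1) ^ β))
      (ENNReal.ofReal (zeta β)) := h0 ▸ ENNReal.summable.hasSum
  have h2 := HasSum.of_nat_of_neg_add_one (M := ℝ≥0∞)
    (f := fun k : ℤ => if k = 0 then 0 else ENNReal.ofReal (|(k : ℝ)| ^ (-β)))
    (m := ENNReal.ofReal (zeta β)) (m' := ENNReal.ofReal (zeta β)) ?_ ?_
  · rw [powSum, h2.tsum_eq, two_mul, ENNReal.ofReal_add] <;> exact (zeta_pos hβ).le
  · have : ∑' n : ℕ, (if (n : ℤ) = 0 then 0 else ENNReal.ofReal (|((n : ℤ) : ℝ)| ^ (-β))) =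
        ENNReal.ofReal (zeta β) := by
      rw [tsum_eq_zero_add' ENNReal.summable, ← h0]
      simp only [Nat.cast_zero, if_true, zero_add]
      refine tsum_congr fun n => ?_
      have hn : (((n + 1 : ℕ) : ℤ)) ≠ 0 := by positivity
      have hn' : (0 : ℝ) ≤ (n : ℝ) + 1 := by positivity
      rw [if_neg hn]
      push_cast
      rw [abs_of_nonneg hn', Real.rpow_neg hn', one_div]
    exact this ▸ ENNReal.summable.hasSum
  · convert h1 using 2 with n
    have hn : -((n : ℤ) + 1) ≠ 0 := by omega
    have hn' : (0 : ℝ) ≤ (n : ℝ) + 1 := by positivity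
    rw [if_neg hn]
    push_cast
    rw [abs_neg, abs_of_nonneg hn', Real.rpow_neg hn', one_div]

lemma powSum_ne_top {β : ℝ} (hβ : 1 < β) : powSum β ≠ ∞ := by
  rw [powSum_eq hβ]; exact ENNReal.ofReal_ne_top

lemma tsum_pi_succ {d : ℕ} (F : (Fin (d + 1) → ℤ) → ℝ≥0∞) :
    ∑' h, F h = ∑' k : ℤ, ∑' h : Fin d → ℤ, F (Fin.snoc h k) := by
  rw [← ENNReal.tsum_prod, ← (Fin.snocEquiv fun _ : Fin (d + 1) => ℤ).tsum_eq]
  rfl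

lemma vecWeight_snoc {a : ℝ} {g : ℕ → ℝ} {d : ℕ} (h : Fin d → ℤ) (k : ℤ) :
    vecWeight a g (Fin.snoc h k : Fin (d + 1) → ℤ) =
      vecWeight a g h * freqWeight a (g d) k := by
  simp [vecWeight, Fin.prod_univ_castSucc]

lemma freqWeight_of_ne {a g : ℝ} {k : ℤ} (hk : k ≠ 0) :
    freqWeight a g k = g * |(k : ℝ)| ^ (-a) := if_neg hk

lemma freqWeight_zero {a g : ℝ} : freqWeight a g 0 = 1 := if_pos rfl

lemma tsum_freqWeight {a g : ℝ} (hg : 0 < g) :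
    ∑' k, ENNReal.ofReal (freqWeight a g k) = 1 + ENNReal.ofReal g * powSum a := by
  rw [ENNReal.tsum_eq_add_tsum_ite 0, freqWeight_zero, ENNReal.ofReal_one, powSum,
    ← ENNReal.tsum_mul_left]
  congr 1
  refine tsum_congr fun k => ?_
  split_ifs with hk
  · simp
  · rw [freqWeight_of_ne hk, ENNReal.ofReal_mul hg.le]

lemma tsum_vecWeight {a : ℝ} {g : ℕ → ℝ} (hg : ∀ j, 0 < g j) (d : ℕ) :
    ∑' h : Fin d → ℤ, ENNReal.ofReal (vecWeight a g h) =
      ∏ j ∈ Finset.range d, (1 + ENNReal.ofReal (g j) * powSum a) := by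
  induction d with
  | zero => rw [tsum_eq_single 0 fun h hh => (hh (Subsingleton.elim _ _)).elim]; simp [vecWeight]
  | succ d ih =>
    rw [tsum_pi_succ, Finset.prod_range_succ, ← ih, ← tsum_freqWeight (hg d),
      ← ENNReal.tsum_mul_left]
    refine tsum_congr fun k => ?_
    rw [← ENNReal.tsum_mul_right]
    refine tsum_congr fun h => ?_
    rw [vecWeight_snoc, ENNReal.ofReal_mul (vecWeight_pos hg h).le]

lemma prod_one_add_ne_top {β : ℝ} (hβ : 1 < β) (g : ℕ → ℝ) (d : ℕ) :
    ∏ j ∈ Finset.range d, (1 + ENNReal.ofReal (g j) * powSum β) ≠ ∞ :=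
  ENNReal.prod_ne_top fun _ _ => ENNReal.add_ne_top.2 ⟨ENNReal.one_ne_top,
    ENNReal.mul_ne_top ENNReal.ofReal_ne_top (powSum_ne_top hβ)⟩

lemma dualSum_ne_top {N : ℕ} {a : ℝ} (ha : 1 < a) {g : ℕ → ℝ} (hg : ∀ j, 0 < g j) {s : ℕ}
    (z : Fin s → ℤ) : dualSum N a g z ≠ ∞ := by
  refine ne_top_of_le_ne_top (prod_one_add_ne_top ha g s) ?_
  rw [← tsum_vecWeight hg, dualSum]
  refine ENNReal.tsum_le_tsum fun h => ?_
  split_ifs <;> simp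

lemma freqWeight_rpow {a g l : ℝ} (hg : 0 < g) (k : ℤ) :
    freqWeight a g k ^ l = freqWeight (a * l) (g ^ l) k := by
  unfold freqWeight
  split_ifs with hk
  · exact Real.one_rpow l
  · rw [Real.mul_rpow hg.le (by positivity), ← Real.rpow_mul (abs_nonneg _), neg_mul]

/-- Powers of weights are again weights of the same shape, so everything proved for `(a, g)` also
applies after the exponent `l` has been introduced. -/
lemma vecWeight_rpow {a l : ℝ} {g : ℕ → ℝ} (hg : ∀ j, 0 < g j) {s : ℕ} (h : Fin s → ℤ) :
    vecWeight a g h ^ l = vecWeight (a * l) (fun j => g j ^ l) h := by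
  rw [vecWeight, vecWeight, ← Real.finsetProd_rpow _ (fun j : Fin s => freqWeight a (g j) (h j))
    fun j _ => (freqWeight_pos (hg j) _).le]
  exact Finset.prod_congr rfl fun j _ => freqWeight_rpow (hg j) _

/-- Concave powers vanishing at 0 are subadditive; the finite case passes to the supremum over
finite sets. -/
lemma tsum_rpow_le {ι : Type*} (f : ι → ℝ≥0∞) {l : ℝ} (h0 : 0 < l) (h1 : l ≤ 1) :
    (∑' i, f i) ^ l ≤ ∑' i, f i ^ l := by
  rw [← ENNReal.le_rpow_inv_iff h0, ENNReal.tsum_eq_iSup_sum]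
  refine iSup_le fun F => ?_
  rw [ENNReal.le_rpow_inv_iff h0]
  refine le_trans ?_ (ENNReal.sum_le_tsum F)
  classical
  induction F using Finset.induction_on with
  | empty => simp [h0]
  | insert i F hi ih =>
    rw [Finset.sum_insert hi, Finset.sum_insert hi]
    exact (ENNReal.rpow_add_le_add_rpow _ _ h0.le h1).trans (by gcongr)

/-! ### Adding one component -/

/-- The contribution to `dualSum` of the frequencies with nonzero last coordinate, when the
component `v` is appended to `z`. -/
def dualIncr (N : ℕ) (a : ℝ) (g : ℕ → ℝ) {d : ℕ} (z : Fin d → ℤ) (v : ℤ) : ℝ≥0∞ :=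
  ∑' k : ℤ, ∑' h : Fin d → ℤ, if k ≠ 0 ∧ (N : ℤ) ∣ ∑ j, h j * z j + k * v then
    ENNReal.ofReal (vecWeight a g h * freqWeight a (g d) k) else 0

/-- Frequencies are split by whether the last coordinate vanishes; those with last coordinate 0
reproduce the lower-dimensional sum. -/
lemma dualSum_snoc {N : ℕ} {a : ℝ} {g : ℕ → ℝ} {d : ℕ} (z : Fin d → ℤ) (v : ℤ) :
    dualSum N a g (Fin.snoc z v : Fin (d + 1) → ℤ) = dualSum N a g z + dualIncr N a g z v := by
  have hz : ∀ (h : Fin d → ℤ) (k : ℤ), (Fin.snoc h k : Fin (d + 1) → ℤ) ≠ 0 ↔ h ≠ 0 ∨ k ≠ 0 := by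
    intro h k
    rw [← not_iff_not]
    push Not
    constructor
    · intro H
      constructor
      · funext i
        have := congrFun H i.castSucc
        simpa using this
      · have := congrFun H (Fin.last d)
        simpa using this
    · rintro ⟨rfl, rfl⟩
      funext i
      refine Fin.lastCases ?_ (fun i => ?_) i <;> simp
  rw [dualSum, tsum_pi_succ, ENNReal.tsum_eq_add_tsum_ite 0, dualSum, dualIncr]
  simp only [hz, vecWeight_snoc, Fin.sum_univ_castSucc, Fin.snoc_castSucc, Fin.snoc_last]
  congr 1
  · refine tsum_congr fun h => ?_
    simp [freqWeight_zero]
  · refine tsum_congr fun k => ?_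
    by_cases hk : k = 0 <;> simp [hk]

lemma genVector_succ (b : ℕ) (w z : ℕ → ℕ) (d : ℕ) :
    genVector b w z (d + 1) =
      (Fin.snoc (genVector b w z d) ((b : ℤ) ^ w d * (z d : ℤ)) : Fin (d + 1) → ℤ) := by
  funext i
  refine Fin.lastCases ?_ (fun i => ?_) i <;> simp [genVector]

lemma genVector_congr (b : ℕ) (w : ℕ → ℕ) {z z' : ℕ → ℕ} {d : ℕ} (h : ∀ j < d, z j = z' j) :
    genVector b w z d = genVector b w z' d := by
  funext i
  simp [genVector, h i i.2]

lemma dualIncr_rpow_le {N : ℕ} {a l : ℝ} (h0 : 0 < l) (h1 : l ≤ 1) {g : ℕ → ℝ}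
    (hg : ∀ j, 0 < g j) {d : ℕ} (z : Fin d → ℤ) (v : ℤ) :
    dualIncr N a g z v ^ l ≤ dualIncr N (a * l) (fun j => g j ^ l) z v := by
  refine (tsum_rpow_le _ h0 h1).trans (ENNReal.tsum_le_tsum fun k => ?_)
  refine (tsum_rpow_le _ h0 h1).trans (ENNReal.tsum_le_tsum fun h => ?_)
  have hv := vecWeight_pos (a := a) hg h
  have hf := freqWeight_pos (a := a) (hg d) k
  split_ifs
  · rw [ENNReal.ofReal_rpow_of_pos (mul_pos hv hf), Real.mul_rpow hv.le hf.le, vecWeight_rpow hg,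
      freqWeight_rpow (hg d)]
  · simp [h0]

/-! ### Averaging over the search space -/

/-- The search space as a finite set. -/
def searchFinset (b m w : ℕ) : Finset ℕ :=
  if w < m then (Finset.range (b ^ (m - w))).filter (b ^ (m - w)).Coprime else {1}

lemma mem_searchFinset {b : ℕ} (hb : b.Prime) {m w z : ℕ} :
    z ∈ searchFinset b m w ↔ z ∈ searchSpace b m w := by
  unfold searchFinset searchSpace
  split_ifs with h
  · have hm : 0 < m - w := by omega
    have hm' : 0 < m := by omega
    have hM : 1 < b ^ (m - w) := Nat.one_lt_pow hm.ne' hb.one_lt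
    simp only [Finset.mem_filter, Finset.mem_range, Set.mem_ofPred_eq]
    rw [Nat.coprime_pow_left_iff hm]
    have : Nat.gcd z (b ^ m) = 1 ↔ b.Coprime z := by
      rw [← Nat.Coprime, Nat.coprime_pow_right_iff hm', Nat.coprime_comm]
    rw [this]
    constructor
    · rintro ⟨h1, h2⟩
      refine ⟨?_, by omega, h2⟩
      rcases Nat.eq_zero_or_pos z with rfl | h
      · rw [Nat.coprime_zero_right] at h2
        exact absurd h2 hb.one_lt.ne'
      · exact h
    · rintro ⟨h1, h2, h3⟩
      exact ⟨by omega, h3⟩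
  · simp

lemma one_mem_searchFinset {b : ℕ} (hb : b.Prime) (m w : ℕ) : 1 ∈ searchFinset b m w := by
  unfold searchFinset
  split_ifs with h
  · have hm : m - w ≠ 0 := by omega
    simp [Nat.one_lt_pow hm hb.one_lt]
  · simp

/-- For `w < m` the size is `φ(b^(m-w))`, which is at least half of `b^(m-w)` because `b ≤ 2 (b -
1)`. This is the source of the factor 2 in the error bound. -/
lemma pow_le_card_searchFinset {b : ℕ} (hb : b.Prime) (m w : ℕ) :
    b ^ m ≤ 2 * b ^ w * (searchFinset b m w).card := by
  unfold searchFinset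
  split_ifs with h
  · obtain ⟨n, rfl⟩ : ∃ n, m = w + (n + 1) := ⟨m - w - 1, by omega⟩
    rw [Nat.add_sub_cancel_left, ← Nat.totient_eq_card_coprime,
      Nat.totient_prime_pow_succ hb, pow_add, mul_comm 2, mul_assoc]
    refine Nat.mul_le_mul_left _ ?_
    have := hb.two_le
    calc b ^ (n + 1) = b ^ n * b := pow_succ _ _
      _ ≤ b ^ n * (2 * (b - 1)) := Nat.mul_le_mul_left _ (by omega)
      _ = 2 * (b ^ n * (b - 1)) := by ring
  · rw [Finset.card_singleton, mul_one]
    have := Nat.pow_le_pow_right hb.pos (not_lt.1 h)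
    omega

/-- Since `y` is a unit mod `M`, `a` and `k` are associated mod `M`. -/
lemma gcd_eq_of_dvd_add_mul {M y : ℕ} {a k : ℤ} (hy : M.Coprime y) (h : (M : ℤ) ∣ a + k * y) :
    Int.gcd k M = Int.gcd a M := by
  refine Nat.dvd_antisymm (Int.dvd_gcd ?_ (Int.gcd_dvd_right _ _))
    (Int.dvd_gcd ?_ (Int.gcd_dvd_right _ _))
  · have h1 : (Int.gcd k M : ℤ) ∣ a + k * y := (Int.gcd_dvd_right _ _).trans h
    exact (dvd_add_left ((Int.gcd_dvd_left _ _).mul_right _)).1 h1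
  · have h1 : (Int.gcd a M : ℤ) ∣ a + k * y := (Int.gcd_dvd_right _ _).trans h
    have h2 : (Int.gcd a M : ℤ) ∣ k * y := (dvd_add_right (Int.gcd_dvd_left _ _)).1 h1
    refine IsCoprime.dvd_of_dvd_mul_right ?_ h2
    have h3 : IsCoprime (M : ℤ) (y : ℤ) := Nat.isCoprime_iff_coprime.2 hy
    exact h3.of_isCoprime_of_dvd_left (Int.gcd_dvd_right _ _)

/-- If a solution exists, then `g = gcd(k, M)` equals `gcd(a, M)`, and all solutions lie in one
residue class mod `M / g`, which has `g` members below `M`. Expressing the bound through `gcd(a, M)`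
makes it usable in a sum over `k`. -/
lemma card_filter_dvd_le {M : ℕ} (hM : 0 < M) (a k : ℤ) :
    (((Finset.range M).filter M.Coprime).filter fun y : ℕ => (M : ℤ) ∣ a + k * (y : ℤ)).card ≤
      if (Int.gcd a M : ℤ) ∣ k then Int.gcd a M else 0 := by
  set S := ((Finset.range M).filter M.Coprime).filter fun y : ℕ => (M : ℤ) ∣ a + k * (y : ℤ) with hS
  rcases S.eq_empty_or_nonempty with h0 | ⟨y₀, hy₀⟩
  · simp [h0]
  have hmem : ∀ y ∈ S, y < M ∧ M.Coprime y ∧ (M : ℤ) ∣ a + k * (y : ℤ) := fun y hy => by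
    rw [hS, Finset.mem_filter, Finset.mem_filter, Finset.mem_range] at hy
    exact ⟨hy.1.1, hy.1.2, hy.2⟩
  have hg := gcd_eq_of_dvd_add_mul (hmem y₀ hy₀).2.1 (hmem y₀ hy₀).2.2
  rw [← hg, if_pos (Int.gcd_dvd_left _ _)]
  set g := Int.gcd k M with hgdef
  have hgpos : 0 < g := Int.gcd_pos_of_ne_zero_right _ (by exact_mod_cast hM.ne')
  obtain ⟨L, hL⟩ : g ∣ M := by exact_mod_cast Int.gcd_dvd_right k M
  have hLpos : 0 < L := Nat.pos_of_ne_zero fun h => by rw [h, mul_zero] at hL; omega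
  have hmod : ∀ y ∈ S, ∀ y' ∈ S, y ≡ y' [MOD L] := fun y hy y' hy' => by
    have h1 : (M : ℤ) ∣ k * ((y' : ℤ) - y) := by
      have := dvd_sub (hmem y' hy').2.2 (hmem y hy).2.2
      have h : a + k * (y' : ℤ) - (a + k * (y : ℤ)) = k * ((y' : ℤ) - y) := by ring
      rwa [h] at this
    rw [Nat.modEq_iff_dvd]
    obtain ⟨k', hk'⟩ : (g : ℤ) ∣ k := Int.gcd_dvd_left _ _
    have hg0 : (g : ℤ) ≠ 0 := by exact_mod_cast hgpos.ne'
    have h2 : (L : ℤ) ∣ k' * ((y' : ℤ) - y) := by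
      rw [hk', hL, mul_assoc] at h1
      push_cast at h1
      exact (mul_dvd_mul_iff_left hg0).1 h1
    refine IsCoprime.dvd_of_dvd_mul_left ?_ h2
    have h3 : Int.gcd (g * L) (g * k') = g := by
      have hL' : (M : ℤ) = g * L := by exact_mod_cast hL
      rw [← hk', ← hL', Int.gcd_comm]
    rw [Int.gcd_mul_left, Int.natAbs_natCast] at h3
    rw [Int.isCoprime_iff_gcd_eq_one]
    exact Nat.eq_of_mul_eq_mul_left hgpos (by rw [h3, mul_one])
  have : S.card ≤ (Finset.range g).card := by
    -- Elements of one class mod `L` are separated by their quotients by `L`, which lie below `g`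
    -- because `M = g * L`.
    refine Finset.card_le_card_of_injOn (fun y => y / L) (fun y hy => ?_) fun y hy y' hy' h => ?_
    · simp only [Finset.coe_range, Set.mem_Iio]
      rw [Nat.div_lt_iff_lt_mul hLpos, ← hL]
      exact (hmem y hy).1
    · have h1 := hmod y hy y' hy'
      rw [← Nat.div_add_mod y L, ← Nat.div_add_mod y' L, h1]
      simp only at h
      rw [h]
  simpa using this

/-- Only multiples `g k` contribute, each with the extra factor `g^(-β) g ≤ 1`: the multiplicity `g`
is paid for by the sparsity of the multiples. -/
lemma tsum_dvd_le {β : ℝ} (hβ : 1 < β) {g : ℕ} (hg : 0 < g) :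
    ∑' k : ℤ, (if k ≠ 0 then ENNReal.ofReal (|(k : ℝ)| ^ (-β)) *
      ((if (g : ℤ) ∣ k then g else 0 : ℕ) : ℝ≥0∞) else 0) ≤ powSum β := by
  have hg0 : (g : ℤ) ≠ 0 := by exact_mod_cast hg.ne'
  have hinj : Function.Injective fun k : ℤ => (g : ℤ) * k := mul_right_injective₀ hg0
  rw [← hinj.tsum_eq, powSum]
  · refine ENNReal.tsum_le_tsum fun k => ?_
    by_cases hk : k = 0
    · simp [hk]
    have h1 : (g : ℤ) * k ≠ 0 := mul_ne_zero hg0 hk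
    rw [if_pos h1, if_pos (dvd_mul_right _ _), if_neg hk, ← ENNReal.ofReal_natCast,
      ← ENNReal.ofReal_mul (by positivity)]
    refine ENNReal.ofReal_le_ofReal ?_
    push_cast
    rw [abs_mul, Nat.abs_cast, Real.mul_rpow (by positivity) (abs_nonneg _)]
    have hg1 : (1 : ℝ) ≤ g := by exact_mod_cast hg
    have h2 : (g : ℝ) ^ (-β) * g ≤ 1 := by
      rw [← Real.rpow_add_one (by positivity)]
      exact Real.rpow_le_one_of_one_le_of_nonpos hg1 (by linarith)
    have h3 : (0 : ℝ) ≤ |(k : ℝ)| ^ (-β) := by positivity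
    nlinarith
  · intro k hk
    rw [Function.mem_support] at hk
    by_contra hn
    have : ¬ (g : ℤ) ∣ k := fun ⟨c, hc⟩ => hn ⟨c, hc.symm⟩
    simp [this] at hk

lemma sum_units_le {β : ℝ} (hβ : 1 < β) {M : ℕ} (hM : 0 < M) (a : ℤ) :
    ∑ y ∈ (Finset.range M).filter M.Coprime, ∑' k : ℤ,
      (if k ≠ 0 ∧ (M : ℤ) ∣ a + k * (y : ℤ) then ENNReal.ofReal (|(k : ℝ)| ^ (-β)) else 0) ≤
      powSum β := by
  rw [← Summable.tsum_finsetSum fun _ _ => ENNReal.summable]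
  refine le_trans (ENNReal.tsum_le_tsum fun k => ?_)
    (tsum_dvd_le hβ (g := Int.gcd a M)
      (Int.gcd_pos_of_ne_zero_right _ (by exact_mod_cast hM.ne')))
  by_cases hk : k = 0
  · simp [hk]
  simp only [ne_eq, hk, not_false_eq_true, true_and, if_true]
  rw [← Finset.sum_filter, Finset.sum_const, nsmul_eq_mul, mul_comm]
  gcongr
  exact card_filter_dvd_le hM a k

/-- For `w < m`, divisibility by `b^m` forces `b^w ∣ a`; cancelling `b^w` leaves a sum over units
mod `b^(m-w)`. For `w ≥ m` there is a single candidate, and dropping the congruence suffices. -/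
lemma sum_searchFinset_le {b : ℕ} (hb : b.Prime) {β : ℝ} (hβ : 1 < β) (m w : ℕ) (a : ℤ) :
    ∑ y ∈ searchFinset b m w, ∑' k : ℤ,
      (if k ≠ 0 ∧ ((b ^ m : ℕ) : ℤ) ∣ a + k * ((b : ℤ) ^ w * (y : ℤ)) then
        ENNReal.ofReal (|(k : ℝ)| ^ (-β)) else 0) ≤ powSum β := by
  unfold searchFinset
  split_ifs with h
  · have hN : ((b ^ m : ℕ) : ℤ) = (b : ℤ) ^ w * ((b ^ (m - w) : ℕ) : ℤ) := by
      push_cast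
      rw [← pow_add, Nat.add_sub_cancel' h.le]
    have hb0 : (b : ℤ) ^ w ≠ 0 := pow_ne_zero _ (by exact_mod_cast hb.ne_zero)
    by_cases ha : (b : ℤ) ^ w ∣ a
    · obtain ⟨a', rfl⟩ := ha
      refine le_of_eq_of_le ?_ (sum_units_le hβ (M := b ^ (m - w)) (pow_pos hb.pos _) a')
      refine Finset.sum_congr rfl fun y _ => tsum_congr fun k => ?_
      have : (b : ℤ) ^ w * a' + k * ((b : ℤ) ^ w * (y : ℤ)) = (b : ℤ) ^ w * (a' + k * y) := by
        ring
      simp only [hN, this, mul_dvd_mul_iff_left hb0]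
    · have : ∀ (y : ℕ) (k : ℤ), ¬ ((b ^ m : ℕ) : ℤ) ∣ a + k * ((b : ℤ) ^ w * (y : ℤ)) := by
        intro y k hd
        apply ha
        rw [hN] at hd
        have h1 : (b : ℤ) ^ w ∣ k * ((b : ℤ) ^ w * (y : ℤ)) := ⟨k * y, by ring⟩
        exact (dvd_add_left h1).1 ((dvd_mul_right _ _).trans hd)
      simp only [this, and_false, if_false, tsum_zero, Finset.sum_const_zero, zero_le]
  · rw [Finset.sum_singleton, powSum]
    refine ENNReal.tsum_le_tsum fun k => ?_
    by_cases hk : k = 0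
    · simp [hk]
    · simp only [ne_eq, hk, not_false_eq_true, true_and, if_false]
      split_ifs <;> simp

lemma sum_dualIncr_le {b : ℕ} (hb : b.Prime) {β : ℝ} (hβ : 1 < β) {g : ℕ → ℝ}
    (hg : ∀ j, 0 < g j) (m w : ℕ) {d : ℕ} (z : Fin d → ℤ) :
    ∑ y ∈ searchFinset b m w, dualIncr (b ^ m) β g z ((b : ℤ) ^ w * (y : ℤ)) ≤
      ENNReal.ofReal (g d) * powSum β *
        ∏ j ∈ Finset.range d, (1 + ENNReal.ofReal (g j) * powSum β) := by
  unfold dualIncr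
  have h1 : ∀ y : ℕ, (∑' k : ℤ, ∑' h : Fin d → ℤ,
      if k ≠ 0 ∧ ((b ^ m : ℕ) : ℤ) ∣ ∑ j, h j * z j + k * ((b : ℤ) ^ w * (y : ℤ)) then
        ENNReal.ofReal (vecWeight β g h * freqWeight β (g d) k) else 0) =
      ∑' h : Fin d → ℤ, ENNReal.ofReal (g d) * ENNReal.ofReal (vecWeight β g h) * ∑' k : ℤ,
        if k ≠ 0 ∧ ((b ^ m : ℕ) : ℤ) ∣ ∑ j, h j * z j + k * ((b : ℤ) ^ w * (y : ℤ)) then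
          ENNReal.ofReal (|(k : ℝ)| ^ (-β)) else 0 := fun y => by
    rw [ENNReal.tsum_comm]
    refine tsum_congr fun h => ?_
    rw [← ENNReal.tsum_mul_left]
    refine tsum_congr fun k => ?_
    split_ifs with hk
    · rw [freqWeight_of_ne hk.1, ← ENNReal.ofReal_mul (hg d).le,
        ← ENNReal.ofReal_mul (mul_nonneg (hg d).le (vecWeight_pos hg h).le)]
      congr 1; ring
    · simp
  simp_rw [h1]
  rw [← Summable.tsum_finsetSum fun _ _ => ENNReal.summable, ← tsum_vecWeight hg d,
    ← ENNReal.tsum_mul_left]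
  refine ENNReal.tsum_le_tsum fun h => ?_
  rw [← Finset.mul_sum, mul_right_comm (ENNReal.ofReal (g d)) (powSum β)]
  gcongr
  exact sum_searchFinset_le hb hβ m w _

/-- A component at most as bad as all others in the search space is at most as bad as their mean. -/
lemma dualIncr_rpow_le_of_forall_le {b : ℕ} (hb : b.Prime) {a l : ℝ} (h0 : 0 < l) (h1 : l ≤ 1)
    (hal : 1 < a * l) {g : ℕ → ℝ} (hg : ∀ j, 0 < g j) (m w : ℕ) {d : ℕ} (z : Fin d → ℤ) (v : ℕ)
    (hv : ∀ y ∈ searchFinset b m w, dualIncr (b ^ m) a g z ((b : ℤ) ^ w * (v : ℤ)) ≤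
      dualIncr (b ^ m) a g z ((b : ℤ) ^ w * (y : ℤ))) :
    dualIncr (b ^ m) a g z ((b : ℤ) ^ w * (v : ℤ)) ^ l ≤
      2 * (b : ℝ≥0∞) ^ w / (b : ℝ≥0∞) ^ m * (ENNReal.ofReal (g d ^ l) * powSum (a * l) *
        ∏ j ∈ Finset.range d, (1 + ENNReal.ofReal (g j ^ l) * powSum (a * l))) := by
  set X := dualIncr (b ^ m) a g z ((b : ℤ) ^ w * (v : ℤ)) ^ l
  set R := ENNReal.ofReal (g d ^ l) * powSum (a * l) *
        ∏ j ∈ Finset.range d, (1 + ENNReal.ofReal (g j ^ l) * powSum (a * l))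
  -- The minimum is compared with every candidate, before the exponent `l` is moved inside the sum.
  have h2 : ((searchFinset b m w).card : ℝ≥0∞) * X ≤ R := by
    refine le_trans ?_ (sum_dualIncr_le hb hal (g := fun j => g j ^ l)
      (fun j => Real.rpow_pos_of_pos (hg j) _) m w z)
    rw [← nsmul_eq_mul]
    refine Finset.card_nsmul_le_sum _ _ _ fun y hy => ?_
    refine le_trans ?_ (dualIncr_rpow_le h0 h1 hg z _)
    exact ENNReal.rpow_le_rpow (hv y hy) h0.le
  have h3 : (b : ℝ≥0∞) ^ m ≤ 2 * (b : ℝ≥0∞) ^ w * ((searchFinset b m w).card : ℝ≥0∞) := by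
    exact_mod_cast pow_le_card_searchFinset hb m w
  have hbm : (b : ℝ≥0∞) ^ m ≠ 0 := pow_ne_zero _ (by exact_mod_cast hb.ne_zero)
  have hbt : (b : ℝ≥0∞) ^ m ≠ ∞ := ENNReal.pow_ne_top (ENNReal.natCast_ne_top b)
  rw [← ENNReal.mul_div_right_comm, ENNReal.le_div_iff_mul_le (Or.inl hbm) (Or.inl hbt)]
  calc X * (b : ℝ≥0∞) ^ m ≤ X * (2 * (b : ℝ≥0∞) ^ w * ((searchFinset b m w).card : ℝ≥0∞)) := by
        gcongr
    _ = 2 * (b : ℝ≥0∞) ^ w * (((searchFinset b m w).card : ℝ≥0∞) * X) := by ring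
    _ ≤ _ := by gcongr

/-- The first component is prescribed, not minimized. In dimension one the candidates are all
equivalent, since a unit factor does not affect divisibility by `b^m`, so `z_1 = 1` is a minimizer
too. -/
lemma dualIncr_fin_zero_eq {b m w y : ℕ} (hy : y ∈ searchFinset b m w)
    {a : ℝ} {g : ℕ → ℝ} (z : Fin 0 → ℤ) :
    dualIncr (b ^ m) a g z ((b : ℤ) ^ w * ((1 : ℕ) : ℤ)) =
      dualIncr (b ^ m) a g z ((b : ℤ) ^ w * (y : ℤ)) := by
  have hd : ∀ k : ℤ, ((b ^ m : ℕ) : ℤ) ∣ k * ((b : ℤ) ^ w * ((1 : ℕ) : ℤ)) ↔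
      ((b ^ m : ℕ) : ℤ) ∣ k * ((b : ℤ) ^ w * (y : ℤ)) := fun k => by
    unfold searchFinset at hy
    split_ifs at hy with h
    · have hm : 0 < m - w := by omega
      rw [Finset.mem_filter, Nat.coprime_pow_left_iff hm] at hy
      have hc : IsCoprime ((b ^ m : ℕ) : ℤ) (y : ℤ) :=
        Nat.isCoprime_iff_coprime.2 (hy.2.pow_left m)
      rw [Nat.cast_one, mul_one, ← mul_assoc]
      exact ⟨fun h => h.mul_right _, hc.dvd_of_dvd_mul_right⟩
    · rw [Finset.mem_singleton] at hy
      rw [hy]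
  simp only [dualIncr, Finset.univ_eq_empty, Finset.sum_empty, zero_add, hd]

/-! ### The error of reduced component-by-component constructions -/

lemma IsReducedCBC.dualIncr_le {b : ℕ} (hb : b.Prime) {m : ℕ} {a : ℝ} (ha : 1 < a) {g : ℕ → ℝ}
    (hg : ∀ j, 0 < g j) {w : ℕ → ℕ} {s : ℕ} {z : ℕ → ℕ}
    (hz : IsReducedCBC b m a (prodWeights g) w s z) {d : ℕ} (hd : d < s) {y : ℕ}
    (hy : y ∈ searchFinset b m (w d)) :
    dualIncr (b ^ m) a g (genVector b w z d) ((b : ℤ) ^ w d * (z d : ℤ)) ≤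
      dualIncr (b ^ m) a g (genVector b w z d) ((b : ℤ) ^ w d * (y : ℤ)) := by
  rcases Nat.eq_zero_or_pos d with rfl | hpos
  · rw [hz.1]
    exact (dualIncr_fin_zero_eq hy _).le
  · have h := (hz.2 d hpos hd).2 y ((mem_searchFinset hb).1 hy)
    -- The squared errors on the two sides differ only in the increment; the finite
    -- lower-dimensional sum is then cancelled.
    rw [latticeError_eq (pow_pos hb.pos m) hg, latticeError_eq (pow_pos hb.pos m) hg,
      ENNReal.rpow_le_rpow_iff (by norm_num), genVector_succ, genVector_succ,
      Function.update_self, genVector_congr b w (z := Function.update z d y) (z' := z)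
        fun j hj => Function.update_of_ne hj.ne _ _, dualSum_snoc, dualSum_snoc] at h
    exact (ENNReal.add_le_add_iff_left (dualSum_ne_top ha hg _)).1 h

lemma IsReducedCBC.dualSum_rpow_le {b : ℕ} (hb : b.Prime) {m : ℕ} {a l : ℝ} (h0 : 0 < l)
    (h1 : l ≤ 1) (hal : 1 < a * l) {g : ℕ → ℝ}
    (hg : ∀ j, 0 < g j) {w : ℕ → ℕ} {s : ℕ} {z : ℕ → ℕ}
    (hz : IsReducedCBC b m a (prodWeights g) w s z) {d : ℕ} (hd : d ≤ s) :
    dualSum (b ^ m) a g (genVector b w z d) ^ l ≤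
      2 / (b : ℝ≥0∞) ^ m * ∑ i ∈ Finset.range d, (b : ℝ≥0∞) ^ w i *
        (ENNReal.ofReal (g i ^ l) * powSum (a * l) *
        ∏ j ∈ Finset.range i, (1 + ENNReal.ofReal (g j ^ l) * powSum (a * l))) := by
  have ha : 1 < a := by nlinarith
  induction d with
  | zero =>
    have : dualSum (b ^ m) a g (genVector b w z 0) = 0 := by
      rw [dualSum, ENNReal.tsum_eq_zero]
      intro h
      rw [if_neg fun H => H.1 (Subsingleton.elim _ _)]
    rw [this, ENNReal.zero_rpow_of_pos h0]
    exact zero_le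
  | succ d ih =>
    rw [genVector_succ, dualSum_snoc, Finset.sum_range_succ, mul_add]
    refine (ENNReal.rpow_add_le_add_rpow _ _ h0.le h1).trans (add_le_add (ih (by omega)) ?_)
    refine (dualIncr_rpow_le_of_forall_le hb h0 h1 hal hg m (w d) _ (z d) fun y hy =>
      hz.dualIncr_le hb ha hg (by omega) hy).trans (le_of_eq ?_)
    simp only [div_eq_mul_inv]
    ring

/-! ### The error factor -/

lemma sum_finset_fin (s : ℕ) (F : Finset ℕ → ℝ) :
    ∑ u : Finset (Fin s), F (u.map Fin.valEmbedding) = ∑ t ∈ (Finset.range s).powerset, F t := by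
  refine Finset.sum_nbij (fun u => u.map Fin.valEmbedding) (fun u _ => ?_)
    (fun u _ v _ h => Finset.map_injective _ h) (fun t ht => ?_) fun _ _ => rfl
  · rw [Finset.mem_powerset]
    intro i hi
    obtain ⟨j, _, rfl⟩ := Finset.mem_map.1 hi
    exact Finset.mem_range.2 j.2
  · have ht' : t ⊆ Finset.univ.map (Fin.valEmbedding (n := s)) := by
      rw [Fin.map_valEmbedding_univ]
      intro i hi
      simpa using Finset.mem_powerset.1 (Finset.mem_coe.1 ht) hi
    obtain ⟨u, _, rfl⟩ := Finset.subset_map_iff.1 ht'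
    exact ⟨u, by simp, rfl⟩

/-- Subsets are grouped by their largest element `i`. Monotonicity of `w` makes `b^(w i)` the common
factor, and the free choice of smaller elements expands to the product. -/
lemma sum_powerset_range_eq (b : ℝ) (x : ℕ → ℝ) {w : ℕ → ℕ} (hw : Monotone w) (s : ℕ) :
    ∑ t ∈ (Finset.range s).powerset, (if t.Nonempty then (∏ j ∈ t, x j) * b ^ t.sup w else 0) =
      ∑ i ∈ Finset.range s, b ^ w i * (x i * ∏ j ∈ Finset.range i, (1 + x j)) := by
  induction s with
  | zero => simp
  | succ s ih =>
    rw [Finset.range_add_one, Finset.sum_powerset_insert Finset.notMem_range_self, ih,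
      Finset.sum_insert Finset.notMem_range_self, add_comm, Finset.prod_one_add,
      ← mul_assoc, Finset.mul_sum]
    congr 1
    refine Finset.sum_congr rfl fun t ht => ?_
    have hts := Finset.mem_powerset.1 ht
    have hsup : (insert s t).sup w = w s := by
      rw [Finset.sup_insert, sup_eq_left]
      exact Finset.sup_le fun i hi => hw (Finset.mem_range.1 (hts hi)).le
    rw [if_pos (Finset.insert_nonempty s t), hsup,
      Finset.prod_insert fun h => Finset.notMem_range_self (hts h)]
    ring

/-- The right side telescopes, with increment `x_s b^(w_s) ∏_{j<s} (1 + x_j b^(w_j))`; since `b ≥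
1`, this dominates the summand on the left. The `- 1` makes the induction exact at `s = 0`. -/
lemma sum_le_prod_sub_one {b : ℝ} (hb : 1 ≤ b) {x : ℕ → ℝ} (hx : ∀ j, 0 ≤ x j) (w : ℕ → ℕ)
    (s : ℕ) :
    ∑ i ∈ Finset.range s, b ^ w i * (x i * ∏ j ∈ Finset.range i, (1 + x j)) ≤
      ∏ j ∈ Finset.range s, (1 + x j * b ^ w j) - 1 := by
  induction s with
  | zero => simp
  | succ s ih =>
    rw [Finset.sum_range_succ, Finset.prod_range_succ]
    have h1 : ∏ j ∈ Finset.range s, (1 + x j) ≤ ∏ j ∈ Finset.range s, (1 + x j * b ^ w j) :=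
      Finset.prod_le_prod (fun j _ => by linarith [hx j]) fun j _ => by
        have := le_mul_of_one_le_right (hx j) (one_le_pow₀ hb (n := w j))
        linarith
    have h2 : b ^ w s * (x s * ∏ j ∈ Finset.range s, (1 + x j)) ≤
        b ^ w s * (x s * ∏ j ∈ Finset.range s, (1 + x j * b ^ w j)) := by
      gcongr
      exact hx s
    linarith

/-- The base of the power defining `errorFactor`, up to the factor `2`. -/
def factorSum (b : ℕ) (α : ℝ) (γ : ℕ → ℝ) (δ : ℝ) (w : ℕ → ℕ) (s : ℕ) : ℝ :=
  ∑ i ∈ Finset.range s, (b : ℝ) ^ w i *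
    (γ i ^ (1 / (α - 2 * δ)) * (2 * zeta (α / (α - 2 * δ))) *
      ∏ j ∈ Finset.range i, (1 + γ j ^ (1 / (α - 2 * δ)) * (2 * zeta (α / (α - 2 * δ)))))

lemma errorFactor_eq (b s : ℕ) (α : ℝ) {γ : ℕ → ℝ} (hγ : ∀ j, 0 < γ j) (δ : ℝ) {w : ℕ → ℕ}
    (hw : Monotone w) :
    errorFactor b s α (prodWeights γ s) δ w = (2 * factorSum b α γ δ w s) ^ (α / 2 - δ) := by
  rw [errorFactor, factorSum, ← sum_powerset_range_eq (b : ℝ)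
    (fun j => γ j ^ (1 / (α - 2 * δ)) * (2 * zeta (α / (α - 2 * δ)))) hw, ← sum_finset_fin,
    Finset.sum_filter]
  congr 2
  refine Finset.sum_congr rfl fun u _ => ?_
  have hsup : (u.map Fin.valEmbedding).sup w = u.sup fun j => w j := by
    rw [Finset.sup_map]; rfl
  simp only [Finset.map_nonempty, hsup, Finset.prod_map, Fin.valEmbedding_apply,
    Finset.prod_mul_distrib, Finset.prod_const, prodWeights, Finset.card_map, mul_pow]
  rw [Real.finsetProd_rpow u (fun j : Fin s => γ j) fun j _ => (hγ j).le]

/-! ### Error bounds for constructed vectors -/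

section Bounds

variable {b : ℕ} {α δ : ℝ} {γ : ℕ → ℝ} {w : ℕ → ℕ}

lemma one_le_sub_two_mul (hδ : δ ∈ Set.Ioc (0 : ℝ) ((α - 1) / 2)) : 1 ≤ α - 2 * δ := by
  linarith [hδ.2]

lemma one_lt_div_sub_two_mul (hδ : δ ∈ Set.Ioc (0 : ℝ) ((α - 1) / 2)) :
    1 < α / (α - 2 * δ) := by
  rw [one_lt_div (by linarith [one_le_sub_two_mul hδ])]
  linarith [hδ.1]

lemma coord_nonneg (hγ : ∀ j, 0 < γ j) (hδ : δ ∈ Set.Ioc (0 : ℝ) ((α - 1) / 2)) (j : ℕ) :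
    0 ≤ γ j ^ (1 / (α - 2 * δ)) * (2 * zeta (α / (α - 2 * δ))) := by
  have := zeta_pos (one_lt_div_sub_two_mul hδ)
  have := Real.rpow_pos_of_pos (hγ j) (1 / (α - 2 * δ))
  positivity

lemma factorSum_nonneg (hγ : ∀ j, 0 < γ j) (hδ : δ ∈ Set.Ioc (0 : ℝ) ((α - 1) / 2)) (s : ℕ) :
    0 ≤ factorSum b α γ δ w s := by
  refine Finset.sum_nonneg fun i _ => mul_nonneg (by positivity)
    (mul_nonneg (coord_nonneg hγ hδ i) (Finset.prod_nonneg fun j _ => ?_))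
  linarith [coord_nonneg hγ hδ j]

lemma latticeError_le_errorFactor (hb : b.Prime) (hγ : ∀ j, 0 < γ j) (hw : Monotone w)
    (hδ : δ ∈ Set.Ioc (0 : ℝ) ((α - 1) / 2)) {s m : ℕ} {z : ℕ → ℕ}
    (hz : IsReducedCBC b m α (prodWeights γ) w s z) :
    latticeError (b ^ m) α (prodWeights γ s) (genVector b w z s) ≤
      ENNReal.ofReal (errorFactor b s α (prodWeights γ s) δ w *
        ((b : ℝ) ^ m) ^ (-α / 2 + δ)) := by
  have hτ := one_le_sub_two_mul hδ
  have hτ0 : 0 < α - 2 * δ := by linarith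
  have hβ := one_lt_div_sub_two_mul hδ
  have hβ' : α * (1 / (α - 2 * δ)) = α / (α - 2 * δ) := mul_one_div _ _
  have hl0 : 0 < 1 / (α - 2 * δ) := by positivity
  have hl1 : 1 / (α - 2 * δ) ≤ 1 := by rw [div_le_one hτ0]; exact hτ
  have hz0 := zeta_pos hβ
  have hbm : (0 : ℝ) < (b : ℝ) ^ m := pow_pos (by exact_mod_cast hb.pos) m
  have hT := factorSum_nonneg (b := b) (w := w) hγ hδ s
  have key := hz.dualSum_rpow_le hb hl0 hl1 (by rwa [hβ']) hγ le_rfl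
  rw [hβ', powSum_eq hβ] at key
  have hsum : 2 / (b : ℝ≥0∞) ^ m * ∑ i ∈ Finset.range s, (b : ℝ≥0∞) ^ w i *
        (ENNReal.ofReal (γ i ^ (1 / (α - 2 * δ))) * ENNReal.ofReal (2 * zeta (α / (α - 2 * δ))) *
        ∏ j ∈ Finset.range i, (1 + ENNReal.ofReal (γ j ^ (1 / (α - 2 * δ))) *
          ENNReal.ofReal (2 * zeta (α / (α - 2 * δ))))) =
      ENNReal.ofReal (2 * factorSum b α γ δ w s / (b : ℝ) ^ m) := by
    have hx := coord_nonneg hγ hδ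
    have h1 : ∀ j, ENNReal.ofReal (γ j ^ (1 / (α - 2 * δ))) *
        ENNReal.ofReal (2 * zeta (α / (α - 2 * δ))) =
        ENNReal.ofReal (γ j ^ (1 / (α - 2 * δ)) * (2 * zeta (α / (α - 2 * δ)))) := fun j =>
      (ENNReal.ofReal_mul (Real.rpow_nonneg (hγ j).le _)).symm
    have h2 : ∀ j, 1 + ENNReal.ofReal (γ j ^ (1 / (α - 2 * δ)) *
        (2 * zeta (α / (α - 2 * δ)))) =
        ENNReal.ofReal (1 + γ j ^ (1 / (α - 2 * δ)) * (2 * zeta (α / (α - 2 * δ)))) := fun j => by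
      rw [ENNReal.ofReal_add zero_le_one (hx j), ENNReal.ofReal_one]
    have h3 : ∀ j, 0 ≤ 1 + γ j ^ (1 / (α - 2 * δ)) * (2 * zeta (α / (α - 2 * δ))) := fun j => by
      linarith [hx j]
    have h4 : ∀ n, (b : ℝ≥0∞) ^ n = ENNReal.ofReal ((b : ℝ) ^ n) := fun n => by
      rw [ENNReal.ofReal_pow (by positivity), ENNReal.ofReal_natCast]
    simp_rw [h1, h2, h4]
    rw [mul_div_right_comm, ENNReal.ofReal_mul (by positivity), ENNReal.ofReal_div_of_pos hbm,
      ENNReal.ofReal_ofNat, factorSum, ENNReal.ofReal_sum_of_nonneg]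
    · congr 1
      refine Finset.sum_congr rfl fun i _ => ?_
      rw [ENNReal.ofReal_mul (p := (b : ℝ) ^ w i) (by positivity), ENNReal.ofReal_mul (hx i),
        ENNReal.ofReal_prod_of_nonneg fun j _ => h3 j]
    · intro i _
      exact mul_nonneg (by positivity) (mul_nonneg (hx i) (Finset.prod_nonneg fun j _ => h3 j))
  rw [hsum] at key
  -- The square root of the dual sum is its `1/τ`-th power, which `key` bounds, raised to `τ/2 = α/2
  -- - δ`.
  have he : (1 / 2 : ℝ) = 1 / (α - 2 * δ) * (α / 2 - δ) := by
    have : α / 2 - δ = (α - 2 * δ) / 2 := by ring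
    rw [this]; field_simp
  have hp : 0 ≤ α / 2 - δ := by linarith
  rw [latticeError_eq (pow_pos hb.pos m) hγ, he, ENNReal.rpow_mul, errorFactor_eq b s α hγ δ hw]
  refine (ENNReal.rpow_le_rpow key hp).trans (le_of_eq ?_)
  rw [ENNReal.ofReal_rpow_of_nonneg (by positivity) hp, Real.div_rpow (by positivity) hbm.le,
    div_eq_mul_inv, ← Real.rpow_neg hbm.le]
  congr 3
  ring

lemma factorSum_le_prod (hb : b.Prime) (hγ : ∀ j, 0 < γ j)
    (hδ : δ ∈ Set.Ioc (0 : ℝ) ((α - 1) / 2)) (s : ℕ) :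
    factorSum b α γ δ w s ≤ ∏ j ∈ Finset.range s, (1 + γ j ^ (1 / (α - 2 * δ)) *
          (2 * zeta (α / (α - 2 * δ))) * (b : ℝ) ^ w j) := by
  have := sum_le_prod_sub_one (b := (b : ℝ)) (by exact_mod_cast hb.one_le)
    (coord_nonneg hγ hδ) w s
  rw [factorSum]
  linarith

lemma factorSum_le_exp (hb : b.Prime) (hγ : ∀ j, 0 < γ j)
    (hδ : δ ∈ Set.Ioc (0 : ℝ) ((α - 1) / 2)) (s : ℕ) :
    factorSum b α γ δ w s ≤
      Real.exp (2 * zeta (α / (α - 2 * δ)) * weightSum b α γ δ w s) := by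
  refine (factorSum_le_prod hb hγ hδ s).trans ?_
  rw [weightSum, Finset.mul_sum, Real.exp_sum]
  refine Finset.prod_le_prod (fun j _ => ?_) fun j _ => ?_
  · have := mul_nonneg (coord_nonneg hγ hδ j) (pow_nonneg (Nat.cast_nonneg (α := ℝ) b) (w j))
    linarith
  · refine (add_comm _ _).le.trans ((Real.add_one_le_exp _).trans (le_of_eq ?_))
    congr 1; ring

lemma errorFactor_le_prod (hb : b.Prime) (hγ : ∀ j, 0 < γ j) (hw : Monotone w)
    (hδ : δ ∈ Set.Ioc (0 : ℝ) ((α - 1) / 2)) (s : ℕ) :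
    errorFactor b s α (prodWeights γ s) δ w ≤
        (2 * ∏ j ∈ Finset.range s, (1 + γ j ^ (1 / (α - 2 * δ)) *
          (2 * zeta (α / (α - 2 * δ))) * (b : ℝ) ^ w j)) ^ (α / 2 - δ) := by
  rw [errorFactor_eq b s α hγ δ hw]
  have := factorSum_nonneg (b := b) (w := w) hγ hδ s
  exact Real.rpow_le_rpow (by positivity) (by linarith [factorSum_le_prod (w := w) hb hγ hδ s])
    (by linarith [one_le_sub_two_mul hδ])

lemma errorFactor_le_exp (hb : b.Prime) (hγ : ∀ j, 0 < γ j) (hw : Monotone w)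
    (hδ : δ ∈ Set.Ioc (0 : ℝ) ((α - 1) / 2)) {s : ℕ} {W : ℝ} (hW : weightSum b α γ δ w s ≤ W) :
    errorFactor b s α (prodWeights γ s) δ w ≤
      2 ^ (α / 2 - δ) * Real.exp ((α - 2 * δ) * zeta (α / (α - 2 * δ)) * W) := by
  have hz0 := zeta_pos (one_lt_div_sub_two_mul hδ)
  have hτ := one_le_sub_two_mul hδ
  have h0 := factorSum_nonneg (b := b) (w := w) hγ hδ s
  have h1 : factorSum b α γ δ w s ≤ Real.exp (2 * zeta (α / (α - 2 * δ)) * W) :=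
    (factorSum_le_exp hb hγ hδ s).trans (Real.exp_le_exp.2 (by gcongr))
  rw [errorFactor_eq b s α hγ δ hw]
  calc (2 * factorSum b α γ δ w s) ^ (α / 2 - δ)
      ≤ (2 * Real.exp (2 * zeta (α / (α - 2 * δ)) * W)) ^ (α / 2 - δ) :=
        Real.rpow_le_rpow (by positivity) (by linarith) (by linarith)
    _ = _ := by
      rw [Real.mul_rpow (by norm_num) (Real.exp_pos _).le, ← Real.exp_mul]
      congr 2; ring

end Bounds

/-! ### Existence of constructed vectors and the information complexity -/

/-- The search spaces are finite and nonempty, so the greedy step can be carried out. Changing entry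
`s` leaves the earlier minimizations intact, as they involve only smaller indices. -/
lemma exists_isReducedCBC {b : ℕ} (hb : b.Prime) (m : ℕ) (α : ℝ)
    (γ : ∀ s, Finset (Fin s) → ℝ) (w : ℕ → ℕ) (s : ℕ) :
    ∃ z, IsReducedCBC b m α γ w s z := by
  induction s with
  | zero => exact ⟨fun _ => 1, rfl, fun d _ h => absurd h (Nat.not_lt_zero d)⟩
  | succ s ih =>
    obtain ⟨z, hz⟩ := ih
    rcases Nat.eq_zero_or_pos s with rfl | hs
    · exact ⟨z, hz.1, fun d h1 h2 => by omega⟩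
    obtain ⟨y, hy, hmin⟩ := (searchFinset b m (w s)).exists_min_image
      (fun y => latticeError (b ^ m) α (γ (s + 1)) (genVector b w (Function.update z s y) (s + 1)))
      ⟨1, one_mem_searchFinset hb m (w s)⟩
    refine ⟨Function.update z s y, ?_, fun d h1 h2 => ?_⟩
    · rw [Function.update_of_ne hs.ne, hz.1]
    rcases (Nat.lt_succ_iff.1 h2).eq_or_lt with rfl | hlt
    · rw [Function.update_self]
      refine ⟨(mem_searchFinset hb).1 hy, fun y' hy' => ?_⟩
      rw [Function.update_idem]
      exact hmin y' ((mem_searchFinset hb).2 hy')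
    · rw [Function.update_of_ne hlt.ne]
      refine ⟨(hz.2 d h1 hlt).1, fun y' hy' => ?_⟩
      have e1 : genVector b w (Function.update z s y) (d + 1) = genVector b w z (d + 1) :=
        genVector_congr b w fun j hj => Function.update_of_ne (by omega) _ _
      have e2 : genVector b w (Function.update (Function.update z s y) d y') (d + 1) =
          genVector b w (Function.update z d y') (d + 1) :=
        genVector_congr b w fun j hj => by
          rw [Function.update_comm hlt.ne', Function.update_of_ne (by omega)]
      rw [e1, e2]
      exact (hz.2 d h1 hlt).2 y' hy'

lemma infoComplexity_le {b : ℕ} (hb : b.Prime) {α δ : ℝ} {γ : ℕ → ℝ} (hγ : ∀ j, 0 < γ j)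
    {w : ℕ → ℕ} (hw : Monotone w) (hδ : δ ∈ Set.Ioc (0 : ℝ) ((α - 1) / 2)) {s : ℕ} {W ε : ℝ}
    (hε : ε ∈ Set.Ioc (0 : ℝ) 1) (hW0 : 0 ≤ W) (hW : weightSum b α γ δ w s ≤ W) :
    (infoComplexity α (prodWeights γ) ε s : ℝ≥0∞) ≤
      ENNReal.ofReal (b * (2 * Real.exp (2 * zeta (α / (α - 2 * δ)) * W)) *
        ε ^ (-(2 / (α - 2 * δ)))) := by
  have hz0 := zeta_pos (one_lt_div_sub_two_mul hδ)
  have hτ := one_le_sub_two_mul hδ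
  have hτ0 : 0 < α - 2 * δ := by linarith
  have hb1 : (1 : ℝ) < b := by exact_mod_cast hb.one_lt
  set K := 2 * Real.exp (2 * zeta (α / (α - 2 * δ)) * W) with hK
  have hK1 : 1 ≤ K := by
    have : 1 ≤ Real.exp (2 * zeta (α / (α - 2 * δ)) * W) := Real.one_le_exp (by positivity)
    linarith
  have hE : 1 ≤ ε ^ (-(2 / (α - 2 * δ))) :=
    Real.one_le_rpow_of_pos_of_le_one_of_nonpos hε.1 hε.2 (by
      rw [neg_nonpos]; positivity)
  -- `N = b^(n+1)` is the first power of `b` exceeding `K ε^(-2/τ)`, the size at which the error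
  -- bound equals `ε`; rounding up costs at most a factor `b`.
  obtain ⟨n, hn1, hn2⟩ := exists_nat_pow_near (one_le_mul_of_one_le_of_one_le hK1 hE) hb1
  obtain ⟨z, hz⟩ := exists_isReducedCBC hb (n + 1) α (prodWeights γ) w s
  have hmem : b ^ (n + 1) ∈ {N : ℕ | 1 ≤ N ∧ minimalError N s α (prodWeights γ s) ≤
      ENNReal.ofReal ε * initialError s α (prodWeights γ s)} := by
    refine ⟨Nat.one_le_pow _ _ hb.pos, ?_⟩
    refine (iInf_le _ (latticePoints (b ^ (n + 1)) (genVector b w z s))).trans ?_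
    refine (latticeError_le_errorFactor hb hγ hw hδ hz).trans ?_
    refine le_trans ?_ (le_mul_of_one_le_right zero_le one_le_initialError)
    refine ENNReal.ofReal_le_ofReal ?_
    have h1 := errorFactor_le_exp hb hγ hw hδ hW
    have h2 : (2 : ℝ) ^ (α / 2 - δ) * Real.exp ((α - 2 * δ) * zeta (α / (α - 2 * δ)) * W) =
        K ^ (α / 2 - δ) := by
      rw [hK, Real.mul_rpow (by norm_num) (Real.exp_pos _).le, ← Real.exp_mul]
      congr 2; ring
    rw [h2] at h1
    have h3 : ((b : ℝ) ^ (n + 1)) ^ (-α / 2 + δ) ≤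
        (K * ε ^ (-(2 / (α - 2 * δ)))) ^ (-α / 2 + δ) :=
      Real.rpow_le_rpow_of_nonpos (by positivity) hn2.le (by linarith)
    calc errorFactor b s α (prodWeights γ s) δ w * ((b : ℝ) ^ (n + 1)) ^ (-α / 2 + δ)
        ≤ K ^ (α / 2 - δ) * (K * ε ^ (-(2 / (α - 2 * δ)))) ^ (-α / 2 + δ) := by
          refine mul_le_mul h1 h3 (by positivity) (by positivity)
      _ = ε := by
        have e1 : -(2 / (α - 2 * δ)) * (-α / 2 + δ) = 1 := by field_simp; ring
        have e2 : α / 2 - δ + (-α / 2 + δ) = 0 := by ring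
        rw [Real.mul_rpow (x := K) (by positivity) (by positivity), ← mul_assoc,
          ← Real.rpow_add (by positivity), ← Real.rpow_mul hε.1.le, e1, e2, Real.rpow_zero,
          Real.rpow_one, one_mul]
  have hle : infoComplexity α (prodWeights γ) ε s ≤ ((b ^ (n + 1) : ℕ) : ℕ∞) :=
    iInf₂_le (f := fun (N : ℕ) (_ : N ∈ {N : ℕ | 1 ≤ N ∧ minimalError N s α (prodWeights γ s) ≤
      ENNReal.ofReal ε * initialError s α (prodWeights γ s)}) => (N : ℕ∞)) _ hmem
  refine (ENat.toENNReal_le.2 hle).trans ?_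
  rw [ENat.toENNReal_coe, ← ENNReal.ofReal_natCast]
  refine ENNReal.ofReal_le_ofReal ?_
  push_cast
  rw [pow_succ, mul_comm, mul_assoc]
  gcongr

/-! ### Tractability -/

lemma exists_forall_le_add_of_eventually_le {W φ : ℕ → ℝ} (hW : Monotone W) (hW0 : ∀ s, 0 ≤ W s)
    (hφ : ∀ s, 0 ≤ φ s) (h : ∀ᶠ s in atTop, W s ≤ φ s) :
    ∃ C : ℝ, 0 ≤ C ∧ ∀ s, W s ≤ φ s + C := by
  obtain ⟨s₀, hs₀⟩ := eventually_atTop.1 h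
  refine ⟨W s₀, hW0 s₀, fun s => ?_⟩
  rcases le_total s₀ s with hs | hs
  · linarith [hs₀ s hs, hW0 s₀]
  · linarith [hW hs, hφ s]

/-! ### Growth of the weight sums and the three notions of tractability -/

section Bounds

variable {b : ℕ} {α δ : ℝ} {γ : ℕ → ℝ} {w : ℕ → ℕ}

lemma weightSum_term_nonneg (hγ : ∀ j, 0 < γ j) (j : ℕ) :
    0 ≤ γ j ^ (1 / (α - 2 * δ)) * (b : ℝ) ^ w j :=
  mul_nonneg (Real.rpow_nonneg (hγ j).le _) (by positivity)

lemma weightSum_nonneg (hγ : ∀ j, 0 < γ j) (s : ℕ) : 0 ≤ weightSum b α γ δ w s :=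
  Finset.sum_nonneg fun j _ => weightSum_term_nonneg hγ j

lemma weightSum_monotone (hγ : ∀ j, 0 < γ j) : Monotone (weightSum b α γ δ w) := by
  intro s t hst
  refine Finset.sum_le_sum_of_subset_of_nonneg ?_ fun j _ _ => weightSum_term_nonneg hγ j
  intro j hj
  exact Finset.mem_range.2 ((Finset.mem_range.1 hj).trans_le hst)

lemma limsup_weightSum_nonneg (hγ : ∀ j, 0 < γ j) {A : ℝ}
    (hA : limsup (fun s : ℕ => ((weightSum b α γ δ w s / Real.log s : ℝ) : EReal)) atTop =
      (A : EReal)) : 0 ≤ A := by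
  have : (0 : EReal) ≤ (A : EReal) := by
    rw [← hA]
    refine le_limsup_of_frequently_le' (Frequently.of_forall fun s => ?_)
    -- No restriction on `s` is needed: for `s ≤ 1` the logarithm is 0 and the quotient is 0 by
    -- convention.
    exact EReal.coe_nonneg.2 (div_nonneg (weightSum_nonneg hγ s) (Real.log_natCast_nonneg s))
  exact_mod_cast this

lemma exists_weightSum_le_log (hγ : ∀ j, 0 < γ j) {A η : ℝ} (hη : 0 < η)
    (hA : limsup (fun s : ℕ => ((weightSum b α γ δ w s / Real.log s : ℝ) : EReal)) atTop =
      (A : EReal)) :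
    ∃ C : ℝ, 0 ≤ C ∧ ∀ s : ℕ, weightSum b α γ δ w s ≤ (A + η) * Real.log s + C := by
  have hA0 := limsup_weightSum_nonneg hγ hA
  refine exists_forall_le_add_of_eventually_le (weightSum_monotone hγ) (weightSum_nonneg hγ)
    (fun s => mul_nonneg (by linarith) (Real.log_natCast_nonneg s)) ?_
  have hlt : limsup (fun s : ℕ => ((weightSum b α γ δ w s / Real.log s : ℝ) : EReal)) atTop <
      ((A + η : ℝ) : EReal) := by
    rw [hA]
    exact EReal.coe_lt_coe_iff.2 (by linarith)
  filter_upwards [eventually_lt_of_limsup_lt hlt, eventually_ge_atTop 2] with s hs hs2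
  have hlog : 0 < Real.log s := Real.log_pos (by exact_mod_cast hs2)
  have := EReal.coe_lt_coe_iff.1 hs
  rw [div_lt_iff₀ hlog] at this
  exact this.le

lemma exists_errorFactor_le_rpow (hb : b.Prime) (hγ : ∀ j, 0 < γ j) (hw : Monotone w)
    (hδ : δ ∈ Set.Ioc (0 : ℝ) ((α - 1) / 2)) {A η : ℝ} (hη : 0 < η)
    (hA : limsup (fun s : ℕ => ((weightSum b α γ δ w s / Real.log s : ℝ) : EReal)) atTop =
      (A : EReal)) :
    ∃ c : ℝ, 0 < c ∧ ∀ s : ℕ, 1 ≤ s → errorFactor b s α (prodWeights γ s) δ w ≤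
      c * 2 ^ (α / 2 - δ) * (s : ℝ) ^ (zeta (α / (α - 2 * δ)) * (A + η) * (α - 2 * δ)) := by
  obtain ⟨C, -, hC⟩ := exists_weightSum_le_log hγ hη hA
  refine ⟨Real.exp ((α - 2 * δ) * zeta (α / (α - 2 * δ)) * C), Real.exp_pos _, fun s hs => ?_⟩
  refine (errorFactor_le_exp hb hγ hw hδ (hC s)).trans (le_of_eq ?_)
  have hs0 : (0 : ℝ) < s := by exact_mod_cast hs
  rw [Real.rpow_def_of_pos hs0, mul_comm (Real.exp _), mul_assoc ((2 : ℝ) ^ _),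
    ← Real.exp_add]
  congr 2; ring

lemma exists_complexityBound_of_limsup (hb : b.Prime) (hγ : ∀ j, 0 < γ j) (hw : Monotone w)
    (hδ : δ ∈ Set.Ioc (0 : ℝ) ((α - 1) / 2)) {A η : ℝ} (hη : 0 < η)
    (hA : limsup (fun s : ℕ => ((weightSum b α γ δ w s / Real.log s : ℝ) : EReal)) atTop =
      (A : EReal)) :
    ∃ c : ℝ, 0 < c ∧ ComplexityBound α (prodWeights γ) c (2 / (α - 2 * δ))
      (2 * zeta (α / (α - 2 * δ)) * (A + η)) := by
  obtain ⟨C, hC0, hC⟩ := exists_weightSum_le_log hγ hη hA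
  have hA0 := limsup_weightSum_nonneg hγ hA
  have hb0 : (0 : ℝ) < b := by exact_mod_cast hb.pos
  refine ⟨b * (2 * Real.exp (2 * zeta (α / (α - 2 * δ)) * C)), by positivity,
    fun s hs ε hε => ?_⟩
  refine (infoComplexity_le hb hγ hw hδ hε ?_ (hC s)).trans (le_of_eq ?_)
  · have := mul_nonneg (by linarith : 0 ≤ A + η) (Real.log_natCast_nonneg s)
    linarith
  have hs0 : (0 : ℝ) < s := by exact_mod_cast hs
  have : Real.exp (2 * zeta (α / (α - 2 * δ)) * ((A + η) * Real.log s + C)) =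
      Real.exp (2 * zeta (α / (α - 2 * δ)) * C) *
        (s : ℝ) ^ (2 * zeta (α / (α - 2 * δ)) * (A + η)) := by
    rw [Real.rpow_def_of_pos hs0, ← Real.exp_add]
    congr 1; ring
  rw [this]
  congr 1; ring

lemma polynomiallyTractable_of_limsup (hb : b.Prime) (hγ : ∀ j, 0 < γ j) (hw : Monotone w)
    (hδ : δ ∈ Set.Ioc (0 : ℝ) ((α - 1) / 2)) {A : ℝ}
    (hA : limsup (fun s : ℕ => ((weightSum b α γ δ w s / Real.log s : ℝ) : EReal)) atTop =
      (A : EReal)) :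
    PolynomiallyTractable α (prodWeights γ) ∧
      epsExponent α (prodWeights γ) ≤ ENNReal.ofReal (2 / (α - 2 * δ)) ∧
      dimExponent α (prodWeights γ) ≤ ENNReal.ofReal (2 * zeta (α / (α - 2 * δ)) * A) := by
  have hA0 := limsup_weightSum_nonneg hγ hA
  have hz0 := zeta_pos (one_lt_div_sub_two_mul hδ)
  have hτ := one_le_sub_two_mul hδ
  have hp : 0 ≤ 2 / (α - 2 * δ) := by positivity
  have key : ∀ η : ℝ, 0 < η → ∃ c : ℝ≥0, ComplexityBound α (prodWeights γ) c
      (2 / (α - 2 * δ)).toNNReal (2 * zeta (α / (α - 2 * δ)) * (A + η)).toNNReal := by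
    intro η hη
    obtain ⟨c, hc, h⟩ := exists_complexityBound_of_limsup hb hγ hw hδ hη hA
    refine ⟨c.toNNReal, ?_⟩
    rwa [Real.coe_toNNReal _ hc.le, Real.coe_toNNReal _ hp,
      Real.coe_toNNReal _ (by positivity)]
  refine ⟨?_, ?_, ?_⟩
  · obtain ⟨c, h⟩ := key 1 one_pos
    exact ⟨c, _, _, h⟩
  · obtain ⟨c, h⟩ := key 1 one_pos
    exact iInf₂_le (f := fun (p : ℝ≥0)
      (_ : p ∈ {p : ℝ≥0 | ∃ c q : ℝ≥0, ComplexityBound α (prodWeights γ) c p q}) => (p : ℝ≥0∞))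
      _ ⟨c, _, h⟩
  · refine ENNReal.le_of_forall_pos_le_add fun e he _ => ?_
    have he' : (0 : ℝ) < e := he
    -- This `η` makes the excess `2 ζ(α/τ) η` of the exponent equal to `e`.
    obtain ⟨c, h⟩ := key (e / (2 * zeta (α / (α - 2 * δ)))) (by positivity)
    refine (iInf₂_le (f := fun (q : ℝ≥0)
      (_ : q ∈ {q : ℝ≥0 | ∃ c p : ℝ≥0, ComplexityBound α (prodWeights γ) c p q}) => (q : ℝ≥0∞))
      _ ⟨c, _, h⟩).trans ?_
    have : 2 * zeta (α / (α - 2 * δ)) * (A + e / (2 * zeta (α / (α - 2 * δ)))) =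
        2 * zeta (α / (α - 2 * δ)) * A + e := by
      field_simp
    rw [this]
    exact ENNReal.ofReal_add_le.trans (by rw [ENNReal.ofReal_coe_nnreal])

lemma weightSum_le_of_hasSum (hγ : ∀ j, 0 < γ j) {B : ℝ}
    (hB : HasSum (fun j : ℕ => γ j ^ (1 / (α - 2 * δ)) * (b : ℝ) ^ w j) B) (s : ℕ) :
    weightSum b α γ δ w s ≤ B :=
  sum_le_hasSum _ (fun j _ => weightSum_term_nonneg hγ j) hB

lemma exists_complexityBound_of_hasSum (hb : b.Prime) (hγ : ∀ j, 0 < γ j) (hw : Monotone w)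
    (hδ : δ ∈ Set.Ioc (0 : ℝ) ((α - 1) / 2)) {B : ℝ}
    (hB : HasSum (fun j : ℕ => γ j ^ (1 / (α - 2 * δ)) * (b : ℝ) ^ w j) B) :
    ∃ c : ℝ, 0 < c ∧ ComplexityBound α (prodWeights γ) c (2 / (α - 2 * δ)) 0 := by
  have hb0 : (0 : ℝ) < b := by exact_mod_cast hb.pos
  refine ⟨b * (2 * Real.exp (2 * zeta (α / (α - 2 * δ)) * B)), by positivity,
    fun s _ ε hε => ?_⟩
  rw [Real.rpow_zero, mul_one]
  exact infoComplexity_le hb hγ hw hδ hε (hB.nonneg (weightSum_term_nonneg hγ))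
    (weightSum_le_of_hasSum hγ hB s)

lemma stronglyTractable_of_complexityBound {γ : ∀ s, Finset (Fin s) → ℝ} {c p : ℝ} (hc : 0 ≤ c)
    (hp : 0 ≤ p) (h : ComplexityBound α γ c p 0) :
    StronglyPolynomiallyTractable α γ ∧ strongEpsExponent α γ ≤ ENNReal.ofReal p := by
  have h' : ComplexityBound α γ c.toNNReal p.toNNReal 0 := by
    rwa [Real.coe_toNNReal _ hc, Real.coe_toNNReal _ hp]
  exact ⟨⟨_, _, h'⟩, iInf₂_le (f := fun (p : ℝ≥0)
      (_ : p ∈ {p : ℝ≥0 | ∃ c : ℝ≥0, ComplexityBound α γ c p 0}) => (p : ℝ≥0∞)) _ ⟨_, h'⟩⟩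

lemma log_le_mul_add {κ x : ℝ} (hκ : 0 < κ) (hx : 0 < x) :
    Real.log x ≤ κ * x + (-1 - Real.log κ) := by
  have := Real.log_le_sub_one_of_pos (mul_pos hκ hx)
  rw [Real.log_mul hκ.ne' hx.ne'] at this
  linarith

/-- At the endpoint `δ = (α - 1)/2` one has `τ = 1`, and the weight sum is the one in the
hypothesis. Then `log N_min` is at most a constant plus `2 ζ(α) W s + 2 log ε⁻¹`, which is `o(s)`
plus a logarithm of `ε⁻¹`. -/
lemma weaklyTractable_of_tendsto (hb : b.Prime) (hα : 1 < α) (hγ : ∀ j, 0 < γ j)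
    (hw : Monotone w)
    (h : Tendsto (fun s : ℕ => (1 / (s : ℝ)) * ∑ j ∈ Finset.range s, γ j * (b : ℝ) ^ w j)
      atTop (𝓝 0)) :
    WeaklyTractable α (prodWeights γ) := by
  set δ := (α - 1) / 2 with hδdef
  have hδ : δ ∈ Set.Ioc (0 : ℝ) ((α - 1) / 2) := ⟨by linarith, le_rfl⟩
  have hτ : α - 2 * δ = 1 := by rw [hδdef]; ring
  set W := weightSum b α γ δ w with hWdef
  have hWeq : ∀ s, W s = ∑ j ∈ Finset.range s, γ j * (b : ℝ) ^ w j := fun s => by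
    simp [hWdef, weightSum, hτ]
  have hW0 : ∀ s, 0 ≤ W s := weightSum_nonneg hγ
  set Z := zeta α with hZ
  have hZ0 : 0 < Z := zeta_pos hα
  have hb0 : (0 : ℝ) < b := by exact_mod_cast hb.pos
  have hbd : ∀ (s : ℕ), ∀ ε ∈ Set.Ioc (0 : ℝ) 1,
      (infoComplexity α (prodWeights γ) ε s : ℝ≥0∞) ≤
        ENNReal.ofReal (b * (2 * Real.exp (2 * Z * W s)) * ε ^ (-(2 : ℝ))) := by
    intro s ε hε
    have := infoComplexity_le hb hγ hw hδ hε (hW0 s) (le_refl (W s))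
    rwa [hτ, div_one, div_one] at this
  have hfin : ∀ (s : ℕ), ∀ ε ∈ Set.Ioc (0 : ℝ) 1, infoComplexity α (prodWeights γ) ε s ≠ ⊤ := by
    intro s ε hε htop
    have := hbd s ε hε
    rw [htop] at this
    simp at this
  have hlog : ∀ (s : ℕ), ∀ ε ∈ Set.Ioc (0 : ℝ) 1,
      Real.log ((infoComplexity α (prodWeights γ) ε s).toNat : ℝ) ≤
        Real.log (2 * b) + 2 * Z * W s + 2 * Real.log ε⁻¹ := by
    intro s ε hε
    have hval : Real.log (b * (2 * Real.exp (2 * Z * W s)) * ε ^ (-(2 : ℝ))) =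
        Real.log (2 * b) + 2 * Z * W s + 2 * Real.log ε⁻¹ := by
      have hεp := Real.rpow_pos_of_pos hε.1 (-(2 : ℝ))
      have hexp := Real.exp_pos (2 * Z * W s)
      rw [Real.log_mul (by positivity) hεp.ne', Real.log_rpow hε.1, Real.log_inv,
        ← mul_assoc, Real.log_mul (by positivity) hexp.ne', Real.log_exp, mul_comm (b : ℝ)]
      ring
    rw [← hval]
    obtain ⟨n, hn⟩ := ENat.ne_top_iff_exists.1 (hfin s ε hε)
    have hle := hbd s ε hε
    rw [← hn, ENat.toENNReal_coe, ← ENNReal.ofReal_natCast] at hle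
    rw [← hn, ENat.toNat_natCast]
    have hpos : 0 < (b : ℝ) * (2 * Real.exp (2 * Z * W s)) * ε ^ (-(2 : ℝ)) := by
      have := Real.rpow_pos_of_pos hε.1 (-(2 : ℝ))
      positivity
    have hle' := (ENNReal.ofReal_le_ofReal_iff hpos.le).1 hle
    -- The value 0 need not be ruled out: `Real.log 0 = 0`, and the bound is nonnegative.
    rcases Nat.eq_zero_or_pos n with rfl | hn0
    · rw [Nat.cast_zero, Real.log_zero, hval]
      have h1 : 0 ≤ Real.log (2 * b) := Real.log_nonneg (by
        have : (1 : ℝ) ≤ b := by exact_mod_cast hb.one_le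
        linarith)
      have h2 : 0 ≤ Real.log ε⁻¹ := Real.log_nonneg ((one_le_inv₀ hε.1).2 hε.2)
      have := hW0 s
      positivity
    · exact Real.log_le_log (by exact_mod_cast hn0) hle'
  refine ⟨fun s _ => hfin s, tendsto_order.2 ⟨fun a ha => ?_, fun κ hκ => ?_⟩⟩
  · filter_upwards [mem_inf_of_right (mem_principal_self _)] with x hx
    have hx' : 1 ≤ x.1 ∧ x.2 ∈ Set.Ioc (0 : ℝ) 1 := hx
    have := inv_pos.2 hx'.2.1
    exact ha.trans_le (div_nonneg (Real.log_natCast_nonneg _) (by positivity))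
  · obtain ⟨C, -, hC⟩ := exists_forall_le_add_of_eventually_le (W := W)
      (φ := fun s => κ / (4 * Z) * s) (weightSum_monotone hγ) hW0 (fun s => by positivity) (by
        have hk : 0 < κ / (4 * Z) := by positivity
        filter_upwards [h.eventually_lt_const hk, eventually_ge_atTop 1] with s hs hs1
        have hs0 : (0 : ℝ) < s := by exact_mod_cast hs1
        rw [← hWeq, one_div, inv_mul_lt_iff₀ hs0] at hs
        linarith)
    -- The slopes `κ/(4Z)` for `W` and `κ/4` for the logarithm give `log N_min ≤ (κ/2)(s + ε⁻¹) +
    -- D`, and `D` is below the other half of `κ (s + ε⁻¹)` once `s + ε⁻¹ > 2D/κ`.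
    set D := Real.log (2 * b) + 2 * Z * C + 2 * (-1 - Real.log (κ / 4)) with hD
    have hev : ∀ᶠ x : ℕ × ℝ in comap (fun x : ℕ × ℝ => (x.1 : ℝ) + x.2⁻¹) atTop ⊓
        𝓟 {x : ℕ × ℝ | 1 ≤ x.1 ∧ x.2 ∈ Set.Ioc (0 : ℝ) 1}, 2 * D / κ < (x.1 : ℝ) + x.2⁻¹ :=
      (tendsto_comap.eventually (eventually_gt_atTop _)).filter_mono inf_le_left
    filter_upwards [hev, mem_inf_of_right (mem_principal_self _)] with x hxt hx
    have hx' : 1 ≤ x.1 ∧ x.2 ∈ Set.Ioc (0 : ℝ) 1 := hx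
    have hinv := inv_pos.2 hx'.2.1
    have ht : 0 < (x.1 : ℝ) + x.2⁻¹ := by positivity
    rw [div_lt_iff₀ ht]
    have h1 := hlog x.1 x.2 hx'.2
    have h2 := log_le_mul_add (κ := κ / 4) (by positivity) hinv
    have h3 : 2 * Z * W x.1 ≤ κ / 2 * x.1 + 2 * Z * C := by
      have := mul_le_mul_of_nonneg_left (hC x.1) (by positivity : 0 ≤ 2 * Z)
      refine this.trans (le_of_eq ?_)
      field_simp
      ring
    rw [div_lt_iff₀ hκ] at hxt
    linarith

end Bounds

end Korobov

end

theorem corollary2 (b : ℕ) (hb : b.Prime) (α : ℝ) (hα : 1 < α)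
    (γ : ℕ → ℝ) (hγ : ∀ j, 0 < γ j) (w : ℕ → ℕ) (hw : Monotone w) :
    -- (1) the factor in the error bound, and its estimate by a product
    (∀ δ ∈ Set.Ioc (0 : ℝ) ((α - 1) / 2), ∀ s : ℕ, 1 ≤ s →
      (∀ m : ℕ, 1 ≤ m → ∀ z : ℕ → ℕ, IsReducedCBC b m α (prodWeights γ) w s z →
        latticeError (b ^ m) α (prodWeights γ s) (genVector b w z s) ≤
          ENNReal.ofReal (errorFactor b s α (prodWeights γ s) δ w *
            ((b : ℝ) ^ m) ^ (-α / 2 + δ))) ∧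
      errorFactor b s α (prodWeights γ s) δ w ≤
        (2 * ∏ j ∈ Finset.range s, (1 + γ j ^ (1 / (α - 2 * δ)) *
          (2 * zeta (α / (α - 2 * δ))) * (b : ℝ) ^ w j)) ^ (α / 2 - δ)) ∧
    -- (2) polynomial tractability
    (∀ δ ∈ Set.Ioc (0 : ℝ) ((α - 1) / 2), ∀ A : ℝ,
      limsup (fun s : ℕ => ((weightSum b α γ δ w s / Real.log s : ℝ) : EReal)) atTop = (A : EReal) →
      (∀ η : ℝ, 0 < η →
        (∃ c : ℝ, 0 < c ∧ ∀ s : ℕ, 1 ≤ s →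
          errorFactor b s α (prodWeights γ s) δ w ≤ c * 2 ^ (α / 2 - δ) *
            (s : ℝ) ^ (zeta (α / (α - 2 * δ)) * (A + η) * (α - 2 * δ)) ∧
          ∀ m : ℕ, 1 ≤ m → ∀ z : ℕ → ℕ, IsReducedCBC b m α (prodWeights γ) w s z →
            latticeError (b ^ m) α (prodWeights γ s) (genVector b w z s) ≤
              ENNReal.ofReal (c * 2 ^ (α / 2 - δ) *
                (s : ℝ) ^ (zeta (α / (α - 2 * δ)) * (A + η) * (α - 2 * δ)) *
                ((b : ℝ) ^ m) ^ (-α / 2 + δ))) ∧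
        (∃ c : ℝ, 0 < c ∧ ComplexityBound α (prodWeights γ) c (2 / (α - 2 * δ))
          (2 * zeta (α / (α - 2 * δ)) * (A + η)))) ∧
      PolynomiallyTractable α (prodWeights γ) ∧
      epsExponent α (prodWeights γ) ≤ ENNReal.ofReal (2 / (α - 2 * δ)) ∧
      dimExponent α (prodWeights γ) ≤ ENNReal.ofReal (2 * zeta (α / (α - 2 * δ)) * A)) ∧
    -- (3) strong polynomial tractability
    (∀ δ ∈ Set.Ioc (0 : ℝ) ((α - 1) / 2), ∀ B : ℝ,
      HasSum (fun j : ℕ => γ j ^ (1 / (α - 2 * δ)) * (b : ℝ) ^ w j) B →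
      (∀ s : ℕ, 1 ≤ s →
        errorFactor b s α (prodWeights γ s) δ w ≤
          2 ^ (α / 2 - δ) * Real.exp ((α - 2 * δ) * zeta (α / (α - 2 * δ)) * B) ∧
        ∀ m : ℕ, 1 ≤ m → ∀ z : ℕ → ℕ, IsReducedCBC b m α (prodWeights γ) w s z →
          latticeError (b ^ m) α (prodWeights γ s) (genVector b w z s) ≤
            ENNReal.ofReal (2 ^ (α / 2 - δ) *
              Real.exp ((α - 2 * δ) * zeta (α / (α - 2 * δ)) * B) *
              ((b : ℝ) ^ m) ^ (-α / 2 + δ))) ∧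
      (∃ c : ℝ, 0 < c ∧ ComplexityBound α (prodWeights γ) c (2 / (α - 2 * δ)) 0) ∧
      StronglyPolynomiallyTractable α (prodWeights γ) ∧
      strongEpsExponent α (prodWeights γ) ≤ ENNReal.ofReal (2 / (α - 2 * δ))) ∧
    -- (4) weak tractability
    (Tendsto (fun s : ℕ => (1 / (s : ℝ)) * ∑ j ∈ Finset.range s, γ j * (b : ℝ) ^ w j) atTop (𝓝 0) →
      WeaklyTractable α (prodWeights γ)) := by
  refine ⟨fun δ hδ s _ => ⟨fun m _ z hz => latticeError_le_errorFactor hb hγ hw hδ hz,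
    errorFactor_le_prod hb hγ hw hδ s⟩, fun δ hδ A hA => ⟨fun η hη => ⟨?_,
    exists_complexityBound_of_limsup hb hγ hw hδ hη hA⟩,
    polynomiallyTractable_of_limsup hb hγ hw hδ hA⟩, fun δ hδ B hB => ⟨fun s _ => ?_, ?_⟩,
    weaklyTractable_of_tendsto hb hα hγ hw⟩
  · obtain ⟨c, hc, h⟩ := exists_errorFactor_le_rpow hb hγ hw hδ hη hA
    refine ⟨c, hc, fun s hs => ⟨h s hs, fun m _ z hz => ?_⟩⟩
    refine (latticeError_le_errorFactor hb hγ hw hδ hz).trans (ENNReal.ofReal_le_ofReal ?_)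
    exact mul_le_mul_of_nonneg_right (h s hs) (by positivity)
  · have h := errorFactor_le_exp hb hγ hw hδ (weightSum_le_of_hasSum hγ hB s)
    refine ⟨h, fun m _ z hz => ?_⟩
    refine (latticeError_le_errorFactor hb hγ hw hδ hz).trans (ENNReal.ofReal_le_ofReal ?_)
    exact mul_le_mul_of_nonneg_right h (by positivity)
  · obtain ⟨c, hc, h⟩ := exists_complexityBound_of_hasSum hb hγ hw hδ hB
    have hτ := one_le_sub_two_mul hδ
    exact ⟨⟨c, hc, h⟩, stronglyTractable_of_complexityBound hc.le (by positivity) h⟩
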